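/- Let $d\in\{2,3\}$, $k\ge 1$. Let $\Omega\subset\mathbb{R}^d$ be open and bounded, $\Gamma=\partial\Omega$, and let $\widehat{\mathcal T}_h$ be a finite conforming mesh of closed nondegenerate simplices covering $\Omega$, with mesh size parameter $h>0$, quasi-uniform and shape regular with constants $\kappa,\rho$: each element $T$ satisfies $\operatorname{diam}T\le h\le\kappa\operatorname{diam}T$ and contains a ball of radius at least $\operatorname{diam}(T)/\rho$. Let $\mathcal T_h=\{T\in\widehat{\mathcal T}_h: T\cap\Omega\ne\emptyset\}$, $\Omega_h^*=\bigcup_{T\in\mathcal T_h}T$, let $\mathcal F_i$ be the set of facets shared by exactly two elements of $\mathcal T_h$, and let $\mathcal F_\Gamma$ be the set of $F\in\mathcal F_i$ for which one of the two adjacent elements meets $\Gamma$. For $F\in\mathcal F_i$ fix a unit normal $\boldsymbol n=\boldsymbol n_F$; put $[\![\phi]\!]=\phi^+-\phi^-$ with $\phi^\pm(x)=\lim_{t\to0^+}\phi(x\pm t\boldsymbol n_F)$, let $\partial_{\boldsymbol n}^j=(\boldsymbol n\cdot\nabla)^j$ be the $j$-th derivative in direction $\boldsymbol n$, and let $(\cdot,\cdot)_F$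 be the $L^2(F)$ inner product. Let $\mathcal V_h=[\mathcal X_h]^d$, where $\mathcal X_h$ is the space of continuous functions on $\Omega_h^*$ whose restriction to every $T\in\mathcal T_h$ is a polynomial of degree at most $k$. Let $\mu,\sigma>0$ and let $\boldsymbol\beta:\Omega_h^*\to\mathbb{R}^d$ be a vector field (the advective velocity, extended to $\Omega_h^*$) that is Lipschitz with constant $L$ on every $T\in\mathcal T_h$. Put $$\phi_{u,T}=\mu+\|\boldsymbol\beta\|_{0,\infty,T}h+\sigma h^2,\qquad \phi_{\beta,T}=\frac{h^2}{\mu+\|\boldsymbol\beta\|_{0,\infty,T}h+\sigma h^2},$$ let $\phi_{u,F},\phi_{\beta,F}$ be the averages over the two elements adjacent to $F$, and put $\overline\phi_{\beta,F}=\|\boldsymbol\beta\|_{0,\infty,F}^2\,\phi_{\beta,F}$. For $\gamma>0$ and $\boldsymbol v\in\mathcal V_h$ define (all forms on the diagonal) $$g_\beta=\gamma_\beta\sum_{F\in\mathcal F_\Gamma}\sum_{j=0}^{k-1}\phi_{\beta,F}h^{2j+1}\|[\![\boldsymbol\beta\cdot\nabla\partial_{\boldsymbol n}^j\boldsymbol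 v]\!]\|_F^2,\qquad g_u=\gamma_u\sum_{F\in\mathcal F_\Gamma}\sum_{j=0}^{k-1}\phi_{u,F}h^{2j+1}\|[\![\nabla\cdot\partial_{\boldsymbol n}^j\boldsymbol v]\!]\|_F^2,$$ $$g_\sigma=\gamma_\sigma\sum_{F\in\mathcal F_\Gamma}\sum_{j=1}^{k}\sigma h^{2j+1}\|[\![\partial_{\boldsymbol n}^j\boldsymbol v]\!]\|_F^2,\qquad g_\mu=\gamma_\mu\sum_{F\in\mathcal F_\Gamma}\sum_{j=1}^{k}\mu h^{2j-1}\|[\![\partial_{\boldsymbol n}^j\boldsymbol v]\!]\|_F^2,$$ $$s_\beta=\gamma_\beta\sum_{F\in\mathcal F_i}\phi_{\beta,F}h\|[\![\boldsymbol\beta\cdot\nabla\boldsymbol v]\!]\|_F^2,\qquad s_u=\gamma_u\sum_{F\in\mathcal F_i}\phi_{u,F}h\|[\![\nabla\cdot\boldsymbol v]\!]\|_F^2,$$ $$\overline g_{\gamma}=\gamma\sum_{F\in\mathcal F_\Gamma}\sum_{j=1}^{k}\overline\phi_{\beta,F}h^{2j-1}\|[\![\partial_{\boldsymbol n}^j\boldsymbol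 v]\!]\|_F^2,\qquad \overline s_{\gamma}=\gamma\sum_{F\in\mathcal F_i}\overline\phi_{\beta,F}h\|[\![\partial_{\boldsymbol n}\boldsymbol v]\!]\|_F^2,$$ $$s_\sigma=\gamma_\sigma\sum_{F\in\mathcal F_i}\sigma h^{3}\|[\![\partial_{\boldsymbol n}\boldsymbol v]\!]\|_F^2,\qquad s_\mu=\gamma_\mu\sum_{F\in\mathcal F_i}\mu h\|[\![\partial_{\boldsymbol n}\boldsymbol v]\!]\|_F^2 .$$ **Claim.** (i) There is a constant $C>0$ depending only on $d,k,\rho,\kappa$ such that for all data as above, all $\gamma_\beta>0$ and all $\boldsymbol u_h\in\mathcal V_h$, $$g_\beta(\boldsymbol u_h,\boldsymbol u_h)\le C\,\overline g_{\gamma_\beta}(\boldsymbol u_h,\boldsymbol u_h),\qquad s_\beta(\boldsymbol u_h,\boldsymbol u_h)\le C\,\overline s_{\gamma_\beta}(\boldsymbol u_h,\boldsymbol u_h).$$ (ii) For every $M$ there is a constant $C>0$ depending only on $d,k,\rho,\kappa,M$ such that for all data as above that satisfy at least one of (a) $L\le M\sigma$, (b) $\|\boldsymbol\beta\|_{0,\infty,T}\le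 M\|\boldsymbol\beta\|_{0,\infty,F}$ for all $F\in\mathcal F_i$ and both elements $T$ adjacent to $F$, all $\gamma_u,\gamma_\sigma,\gamma_\mu>0$ with $\gamma_u\le M\gamma_\sigma$, $\gamma_u\le M\gamma_\mu$, and all $\boldsymbol u_h\in\mathcal V_h$, $$g_u(\boldsymbol u_h,\boldsymbol u_h)\le C\bigl(\overline g_{\gamma_u}+g_\sigma+g_\mu\bigr)(\boldsymbol u_h,\boldsymbol u_h),\qquad s_u(\boldsymbol u_h,\boldsymbol u_h)\le C\bigl(\overline s_{\gamma_u}+s_\sigma+s_\mu\bigr)(\boldsymbol u_h,\boldsymbol u_h).$$ In particular, for fixed $L,\mu,\sigma,\gamma_u,\gamma_\sigma,\gamma_\mu$, all four estimates hold with a constant independent of $h$ and of the position of $\Gamma$ relative to the mesh (take $M$ large enough for (a)). -/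

import Mathlib

noncomputable section

namespace CutFEM

open MeasureTheory Filter Topology
open scoped NNReal Classical

/-- The Euclidean space `ℝ^d`. -/
abbrev Space (d : ℕ) := EuclideanSpace ℝ (Fin d)

/-- The closed simplex with the given vertices. -/
def simplex {d : ℕ} (s : Finset (Space d)) : Set (Space d) :=
  convexHull ℝ (s : Set (Space d))

/-- A (conforming) simplicial mesh: a finite, pure `d`-dimensional simplicial complex. -/
structure Mesh (d : ℕ) where
  complex : Geometry.SimplicialComplex ℝ (Space d)
  finite : complex.faces.Finite
  pure : ∀ s ∈ complex.faces, ∃ t ∈ complex.faces, s ⊆ t ∧ t.card = d + 1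

/-- The elements of a mesh, i.e. its `d`-dimensional simplices, given by their vertex sets. -/
def Mesh.elements {d : ℕ} (K : Mesh d) : Finset (Finset (Space d)) :=
  K.finite.toFinset.filter fun T => T.card = d + 1

/-- Quasi-uniformity and shape regularity with mesh size parameter `h`: all elements have
diameter comparable to `h` (constant `κ`) and contain a ball of comparable radius
(constant `ρ`). -/
def Mesh.IsQuasiUniform {d : ℕ} (K : Mesh d) (ρ κ h : ℝ) : Prop :=
  ∀ T ∈ K.elements,
    Metric.diam (simplex T) ≤ h ∧ h ≤ κ * Metric.diam (simplex T) ∧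
      ∃ (c : Space d) (r : ℝ),
        0 < r ∧ Metric.diam (simplex T) ≤ ρ * r ∧ Metric.closedBall c r ⊆ simplex T

/-- `n` is a unit normal vector of the facet with vertex set `F`. -/
def IsUnitNormal {d : ℕ} (n : Space d) (F : Finset (Space d)) : Prop :=
  ‖n‖ = 1 ∧ ∀ x ∈ F, ∀ y ∈ F, inner ℝ n (x - y) = 0

/-- The supremum over `s` of the Euclidean length of `β`. For the continuous fields and the
simplices considered below this is the `L^∞`-norm on `s`. -/
def supNorm {d : ℕ} (β : Space d → Space d) (s : Set (Space d)) : ℝ :=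
  sSup ((fun x => ‖β x‖) '' s)

/-- The jump `φ⁺ - φ⁻` at `x` in direction `n`, with the one-sided limits
`φ^±(x) = lim_{t → 0+} φ (x ± t n)`. -/
def jump {d : ℕ} {W : Type*} [NormedAddCommGroup W] (n : Space d) (φ : Space d → W)
    (x : Space d) : W :=
  limUnder (𝓝[>] (0 : ℝ)) (fun t => φ (x + t • n)) -
    limUnder (𝓝[>] (0 : ℝ)) (fun t => φ (x - t • n))

/-- The `j`-th derivative of `v` in direction `n`. -/
def normalDeriv {d : ℕ} (n : Space d) (j : ℕ) (v : Space d → Space d) :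
    Space d → Space d :=
  fun x => iteratedFDeriv ℝ j v x fun _ => n

/-- The convective derivative `β · ∇ w`. -/
def convDeriv {d : ℕ} (β w : Space d → Space d) : Space d → Space d :=
  fun x => fderiv ℝ w x (β x)

/-- The divergence of `w`. -/
def divergence {d : ℕ} (w : Space d → Space d) : Space d → ℝ :=
  fun x => ∑ i : Fin d, (fderiv ℝ w x (EuclideanSpace.single i 1)) i

/-- The `L²` inner product on the facet with vertex set `F`, with respect to the
`(d-1)`-dimensional surface measure. -/
def facetInner {d : ℕ} {W : Type*} [NormedAddCommGroup W] [InnerProductSpace ℝ W]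
    (F : Finset (Space d)) (f g : Space d → W) : ℝ :=
  ∫ x in simplex F, inner ℝ (f x) (g x) ∂(μHE[d - 1])

/-- The data of the problem: the background mesh and its mesh size parameter, the physical
domain, the chosen facet normals, the viscosity, the reaction coefficient, and the advective
velocity (extended to the active mesh). -/
structure Config (d : ℕ) where
  mesh : Mesh d
  h : ℝ
  Ω : Set (Space d)
  n : Finset (Space d) → Space d
  μ : ℝ
  σ : ℝ
  β : Space d → Space d

namespace Config

variable {d : ℕ} (c : Config d)

/-- The active mesh: the elements of the background mesh that intersect `Ω`. -/
def active : Finset (Finset (Space d)) :=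
  c.mesh.elements.filter fun T => (simplex T ∩ c.Ω).Nonempty

/-- The union of the active elements. -/
def activeDomain : Set (Space d) := ⋃ T ∈ c.active, simplex T

/-- The facets of the active elements. -/
def facets : Finset (Finset (Space d)) :=
  c.active.biUnion fun T => T.powersetCard d

/-- The active elements that have `F` as a facet. -/
def neighbours (F : Finset (Space d)) : Finset (Finset (Space d)) :=
  c.active.filter fun T => F ⊆ T

/-- The interior facets: those shared by exactly two active elements. -/
def interiorFacets : Finset (Finset (Space d)) :=
  c.facets.filter fun F => (c.neighbours F).card = 2

/-- The ghost penalty facets: interior facets of elements which intersect `Γ = ∂Ω`. -/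
def ghostFacets : Finset (Finset (Space d)) :=
  c.interiorFacets.filter fun F =>
    ∃ T ∈ c.neighbours F, (simplex T ∩ frontier c.Ω).Nonempty

/-- Standing assumptions on the data. On a simplex, a continuous field is of class `W^{1,∞}`
with derivative bounded by `L` exactly if it is Lipschitz with constant `L`. -/
structure Admissible (ρ κ : ℝ) (L : ℝ≥0) : Prop where
  isOpen : IsOpen c.Ω
  isBounded : Bornology.IsBounded c.Ω
  covers : c.Ω ⊆ ⋃ T ∈ c.mesh.elements, simplex T
  h_pos : 0 < c.h
  quasiUniform : c.mesh.IsQuasiUniform ρ κ c.h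
  normal : ∀ F ∈ c.interiorFacets, IsUnitNormal (c.n F) F
  μ_pos : 0 < c.μ
  σ_pos : 0 < c.σ
  lipschitz : ∀ T ∈ c.active, LipschitzOnWith L c.β (simplex T)

/-- On every interior facet the size of `β` is comparable to its size on the two adjacent
elements. -/
def FacetResolved (M : ℝ) : Prop :=
  ∀ F ∈ c.interiorFacets, ∀ T ∈ c.neighbours F,
    supNorm c.β (simplex T) ≤ M * supNorm c.β (simplex F)

/-- The finite element space `X_h` of continuous, piecewise polynomial functions of
order `k`. Only the values on the active domain matter. -/
def scalarSpace (k : ℕ) : Set (Space d → ℝ) :=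
  {v | ContinuousOn v c.activeDomain ∧
    ∀ T ∈ c.active, ∃ p : MvPolynomial (Fin d) ℝ, p.totalDegree ≤ k ∧
      ∀ x ∈ simplex T, v x = MvPolynomial.eval (fun i => x i) p}

/-- The discrete velocity space `V_h = [X_h]^d`. -/
def velocitySpace (k : ℕ) : Set (Space d → Space d) :=
  {v | ∀ i : Fin d, (fun x => v x i) ∈ c.scalarSpace k}

/-- The elementwise parameter `φ_u`. -/
def phiU (T : Finset (Space d)) : ℝ :=
  c.μ + supNorm c.β (simplex T) * c.h + c.σ * c.h ^ 2

/-- The elementwise parameter `φ_β`. -/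
def phiB (T : Finset (Space d)) : ℝ :=
  c.h ^ 2 / (c.μ + supNorm c.β (simplex T) * c.h + c.σ * c.h ^ 2)

/-- The average over an interior facet of an elementwise constant function. -/
def facetMean (φ : Finset (Space d) → ℝ) (F : Finset (Space d)) : ℝ :=
  (1 / 2) * ∑ T ∈ c.neighbours F, φ T

/-- The facet parameter `‖β‖²_{∞,F} φ_β`. -/
def phiBar (F : Finset (Space d)) : ℝ :=
  supNorm c.β (simplex F) ^ 2 * c.facetMean c.phiB F

/-- The inner product `([∂_n^j u], [∂_n^j v])_F` of jumps of normal derivatives. -/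
def normalJump (j : ℕ) (F : Finset (Space d)) (u v : Space d → Space d) : ℝ :=
  facetInner F (jump (c.n F) (normalDeriv (c.n F) j u))
    (jump (c.n F) (normalDeriv (c.n F) j v))

/-- The convective interior penalty `s_β`. -/
def sBeta (γ : ℝ) (u v : Space d → Space d) : ℝ :=
  γ * ∑ F ∈ c.interiorFacets, c.facetMean c.phiB F * c.h *
    facetInner F (jump (c.n F) (convDeriv c.β u)) (jump (c.n F) (convDeriv c.β v))

/-- The divergence interior penalty `s_u`. -/
def sU (γ : ℝ) (u v : Space d → Space d) : ℝ :=
  γ * ∑ F ∈ c.interiorFacets, c.facetMean c.phiU F * c.h *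
    facetInner F (jump (c.n F) (divergence u)) (jump (c.n F) (divergence v))

/-- The convective ghost penalty `g_β`. -/
def gBeta (k : ℕ) (γ : ℝ) (u v : Space d → Space d) : ℝ :=
  γ * ∑ F ∈ c.ghostFacets, ∑ j ∈ Finset.range k, c.facetMean c.phiB F * c.h ^ (2 * j + 1) *
    facetInner F (jump (c.n F) (convDeriv c.β (normalDeriv (c.n F) j u)))
      (jump (c.n F) (convDeriv c.β (normalDeriv (c.n F) j v)))

/-- The divergence ghost penalty `g_u`. -/
def gU (k : ℕ) (γ : ℝ) (u v : Space d → Space d) : ℝ :=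
  γ * ∑ F ∈ c.ghostFacets, ∑ j ∈ Finset.range k, c.facetMean c.phiU F * c.h ^ (2 * j + 1) *
    facetInner F (jump (c.n F) (divergence (normalDeriv (c.n F) j u)))
      (jump (c.n F) (divergence (normalDeriv (c.n F) j v)))

/-- The reactive ghost penalty `g_σ`. -/
def gSigma (k : ℕ) (γ : ℝ) (u v : Space d → Space d) : ℝ :=
  γ * ∑ F ∈ c.ghostFacets, ∑ j ∈ Finset.Icc 1 k,
    c.σ * c.h ^ (2 * j + 1) * c.normalJump j F u v

/-- The viscous ghost penalty `g_μ`. -/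
def gMu (k : ℕ) (γ : ℝ) (u v : Space d → Space d) : ℝ :=
  γ * ∑ F ∈ c.ghostFacets, ∑ j ∈ Finset.Icc 1 k,
    c.μ * c.h ^ (2 * j - 1) * c.normalJump j F u v

/-- The simplified ghost penalty. -/
def gBar (k : ℕ) (γ : ℝ) (u v : Space d → Space d) : ℝ :=
  γ * ∑ F ∈ c.ghostFacets, ∑ j ∈ Finset.Icc 1 k,
    c.phiBar F * c.h ^ (2 * j - 1) * c.normalJump j F u v

/-- The simplified interior penalty. -/
def sBar (γ : ℝ) (u v : Space d → Space d) : ℝ :=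
  γ * ∑ F ∈ c.interiorFacets, c.phiBar F * c.h * c.normalJump 1 F u v

/-- The interior penalty counterpart of `g_σ`: first order jumps on all interior facets. -/
def sSigma (γ : ℝ) (u v : Space d → Space d) : ℝ :=
  γ * ∑ F ∈ c.interiorFacets, c.σ * c.h ^ 3 * c.normalJump 1 F u v

/-- The interior penalty counterpart of `g_μ`: first order jumps on all interior facets. -/
def sMu (γ : ℝ) (u v : Space d → Space d) : ℝ :=
  γ * ∑ F ∈ c.interiorFacets, c.μ * c.h * c.normalJump 1 F u v

end Config

end CutFEM

end

/-!
The comparison is facetwise. Across an interior facet `F` with normal `n`, a finite element function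
`u` is given by two polynomial fields on the two sides, so the jump at a relatively interior point
of `F` of a derivative of `u` is that derivative of the difference `q` of the two fields
(`jump_eq_sub`). Conformity of the mesh enters here: the two elements lie on different sides of `F`
(`inner_mul_inner_neg`). The relative boundary of `F` is a null set for the surface measure.

Splitting a direction into its normal and its tangential part bounds the derivative of `∂ₙ^j q` in
that direction by `∂ₙ^(j+1) q` and the derivatives of `∂ₙ^j q` along the edges of `F`
(`norm_apply_le_of_closedBall_subset`). The coefficients with respect to the edges are bounded by
the inverse of the radius of a ball inside the element, because barycentric coordinates change by at
most one along a radius of that ball. The edges of `F` are the images of the coordinate directions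
under the affine parametrization of `F` over a reference simplex, and the surface measure pulls back
to a multiple of the Lebesgue measure. Hence a scale invariant inverse inequality, which follows
from the equivalence of norms on the space of polynomials of degree at most `k`, bounds the edge
derivatives of `∂ₙ^j q` in `L²(F)` by `∂ₙ^j q` itself (`exists_inverse_affineParam`). The result is

`‖⟦β · ∇ ∂ₙ^j u⟧‖² ≤ C ‖β‖²_{∞,F} (‖⟦∂ₙ^(j+1) u⟧‖² + h⁻² ‖⟦∂ₙ^j u⟧‖²)`,

and the same for the divergence without the factor `‖β‖²_{∞,F}` (`exists_facetEstimates`). For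
`j = 0` the second term vanishes, since `u` is continuous. Summation over `j` and `F` proves the
estimates for the convective penalties.

For the divergence it remains to bound the weight `φ_u` by `φ̄_β + σ h² + μ`. By either of the two
alternative hypotheses, `‖β‖_T h` is bounded by a multiple of `‖β‖_F h + σ h²`. If
`‖β‖_F h ≤ μ + σ h²`, then `φ_u` is bounded by viscosity and reaction alone. Otherwise the
denominator of `φ_β` is of the size of `‖β‖_F h`, so `φ̄_β` is at least of that size too
(`Config.Admissible.facetMean_phiU_le`).
-/

noncomputable section

namespace CutFEM

open MeasureTheory Filter Topology
open scoped NNReal Classical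

/-! ### Polynomial vector fields and their normal derivatives -/

/-- The formal derivative of a polynomial in the direction `v`. -/
def dirDeriv {σ : Type*} (v : σ → ℝ) :
    Derivation ℝ (MvPolynomial σ ℝ) (MvPolynomial σ ℝ) :=
  MvPolynomial.mkDerivation ℝ fun l => MvPolynomial.C (v l)

@[simp]
lemma dirDeriv_X {σ : Type*} (v : σ → ℝ) (l : σ) :
    dirDeriv v (MvPolynomial.X l) = MvPolynomial.C (v l) :=
  MvPolynomial.mkDerivation_X ..

@[simp]
lemma dirDeriv_C {σ : Type*} (v : σ → ℝ) (r : ℝ) : dirDeriv v (MvPolynomial.C r) = 0 :=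
  (dirDeriv v).map_algebraMap r

lemma totalDegree_dirDeriv_le {σ : Type*} (v : σ → ℝ) (p : MvPolynomial σ ℝ) :
    (dirDeriv v p).totalDegree ≤ p.totalDegree := by
  conv_lhs => rw [p.as_sum, map_sum]
  refine MvPolynomial.totalDegree_finsetSum_le fun s hs => ?_
  rw [dirDeriv, MvPolynomial.mkDerivation_monomial]
  refine (MvPolynomial.totalDegree_smul_le _ _).trans ?_
  refine MvPolynomial.totalDegree_finsetSum_le fun i hi => ?_
  simp only [smul_eq_mul]
  refine (MvPolynomial.totalDegree_mul _ _).trans ?_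
  rw [MvPolynomial.totalDegree_C, add_zero]
  refine (MvPolynomial.totalDegree_monomial_le _ _).trans ?_
  refine le_trans ?_ (MvPolynomial.le_totalDegree hs)
  exact Finsupp.degree_mono (tsub_le_self : s - Finsupp.single i 1 ≤ s)

/-- The composition of a polynomial in `d` variables with the affine map
`y ↦ v₀ + ∑ i, y i • a i` from `ℝ^m` to `ℝ^d`. -/
def affineComp {d m : ℕ} (v₀ : Space d) (a : Fin m → Space d) :
    MvPolynomial (Fin d) ℝ →ₐ[ℝ] MvPolynomial (Fin m) ℝ :=
  MvPolynomial.aeval fun l =>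
    MvPolynomial.C (v₀ l) + ∑ i, MvPolynomial.C (a i l) * MvPolynomial.X i

lemma totalDegree_affineComp_le {d m : ℕ} (v₀ : Space d) (a : Fin m → Space d)
    (p : MvPolynomial (Fin d) ℝ) : (affineComp v₀ a p).totalDegree ≤ p.totalDegree := by
  conv_lhs => rw [p.as_sum, map_sum]
  refine MvPolynomial.totalDegree_finsetSum_le fun s hs => ?_
  rw [affineComp, MvPolynomial.aeval_monomial]
  refine (MvPolynomial.totalDegree_mul _ _).trans ?_
  rw [MvPolynomial.algebraMap_eq, MvPolynomial.totalDegree_C, zero_add]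
  refine (MvPolynomial.totalDegree_finsetProd _ _).trans ?_
  refine le_trans ?_ (MvPolynomial.le_totalDegree hs)
  refine Finset.sum_le_sum fun l _ => ?_
  refine (MvPolynomial.totalDegree_pow _ _).trans ?_
  refine (Nat.mul_le_mul_left _ ?_).trans (mul_one _).le
  refine (MvPolynomial.totalDegree_add _ _).trans (max_le (by simp) ?_)
  refine MvPolynomial.totalDegree_finsetSum_le fun i _ => ?_
  refine (MvPolynomial.totalDegree_mul _ _).trans ?_
  simp

lemma eval_affineComp {d m : ℕ} (v₀ : Space d) (a : Fin m → Space d)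
    (p : MvPolynomial (Fin d) ℝ) (y : Fin m → ℝ) :
    MvPolynomial.eval y (affineComp v₀ a p) =
      MvPolynomial.eval (fun l => (v₀ + ∑ i, y i • a i) l) p := by
  induction p using MvPolynomial.induction_on with
  | C r => simp [affineComp]
  | add p q hp hq => simp only [map_add, hp, hq]
  | mul_X p l hp =>
    simp only [map_mul, hp, MvPolynomial.eval_X]
    congr 1
    simp [affineComp, mul_comm]

/-- The chain rule for the composition with an affine map. -/
lemma dirDeriv_affineComp {d m : ℕ} (v₀ : Space d) (a : Fin m → Space d)
    (p : MvPolynomial (Fin d) ℝ) (i : Fin m) :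
    dirDeriv (Pi.single i 1) (affineComp v₀ a p) =
      affineComp v₀ a (dirDeriv (fun l => a i l) p) := by
  induction p using MvPolynomial.induction_on with
  | C r => simp [affineComp]
  | add p q hp hq => simp only [map_add, hp, hq]
  | mul_X p l hp =>
    have hX : affineComp v₀ a (MvPolynomial.X l) =
        MvPolynomial.C (v₀ l) + ∑ i, MvPolynomial.C (a i l) * MvPolynomial.X i := by
      simp [affineComp]
    have hD : dirDeriv (Pi.single i 1) (affineComp v₀ a (MvPolynomial.X l)) =
        MvPolynomial.C (a i l) := by
      rw [hX]
      simp only [map_add, map_sum, dirDeriv_C, zero_add, Derivation.leibniz, dirDeriv_X,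
        smul_eq_mul, mul_zero, add_zero]
      rw [Finset.sum_eq_single i (fun b _ hb => by simp [hb]) (by simp)]
      simp
    have hC : ∀ r : ℝ, affineComp v₀ a (MvPolynomial.C r) = MvPolynomial.C r := by
      intro r; simp [affineComp]
    rw [map_mul, Derivation.leibniz, Derivation.leibniz, hD, hp]
    simp only [smul_eq_mul, map_add, map_mul, dirDeriv_X, hC]

/-- The polynomial vector field with the given components. -/
def polyField {d : ℕ} (p : Fin d → MvPolynomial (Fin d) ℝ) : Space d → Space d :=
  fun x => WithLp.toLp 2 fun i => MvPolynomial.eval (fun l => x l) (p i)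

lemma contDiff_eval {d : ℕ} (p : MvPolynomial (Fin d) ℝ) {N : WithTop ℕ∞} :
    ContDiff ℝ N fun x : Space d => MvPolynomial.eval (fun l => x l) p := by
  induction p using MvPolynomial.induction_on with
  | C r => simpa using contDiff_const
  | add p q hp hq => simpa using hp.add hq
  | mul_X p l hp =>
    simp only [map_mul, MvPolynomial.eval_X]
    exact hp.mul (by fun_prop)

lemma fderiv_eval {d : ℕ} (p : MvPolynomial (Fin d) ℝ) (x v : Space d) :
    fderiv ℝ (fun x : Space d => MvPolynomial.eval (fun l => x l) p) x v =
      MvPolynomial.eval (fun l => x l) (dirDeriv (fun l => v l) p) := by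
  have hd : ∀ p : MvPolynomial (Fin d) ℝ, DifferentiableAt ℝ
      (fun x : Space d => MvPolynomial.eval (fun l => x l) p) x := fun p =>
    (contDiff_eval p (N := 1)).differentiable one_ne_zero x
  induction p using MvPolynomial.induction_on with
  | C r => simp
  | add p q hp hq =>
    simp only [map_add]
    rw [fderiv_fun_add (hd p) (hd q)]
    simp [hp, hq]
  | mul_X p l hp =>
    have hX : DifferentiableAt ℝ (fun x : Space d => x l) x := by fun_prop
    have hX' : fderiv ℝ (fun x : Space d => x l) x v = v l := by
      have : (fun x : Space d => x l) = EuclideanSpace.proj (𝕜 := ℝ) l := by ext; simp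
      rw [this, ContinuousLinearMap.fderiv]; simp
    simp only [map_mul, MvPolynomial.eval_X]
    rw [fderiv_fun_mul (hd p) hX]
    simp [hp, hX', Derivation.leibniz]

lemma contDiff_polyField {d : ℕ} (p : Fin d → MvPolynomial (Fin d) ℝ) {N : WithTop ℕ∞} :
    ContDiff ℝ N (polyField p) := by
  rw [contDiff_euclidean]
  exact fun i => contDiff_eval (p i)

lemma fderiv_polyField {d : ℕ} (p : Fin d → MvPolynomial (Fin d) ℝ) (x v : Space d) :
    fderiv ℝ (polyField p) x v = polyField (fun i => dirDeriv (fun l => v l) (p i)) x := by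
  ext i
  have h : fderiv ℝ (fun y => polyField p y i) x v = (fderiv ℝ (polyField p) x v) i := by
    have := ((EuclideanSpace.proj (𝕜 := ℝ) i).hasFDerivAt.comp x
      ((contDiff_polyField p (N := 1)).differentiable one_ne_zero x).hasFDerivAt).fderiv
    have h2 := congrArg (fun A => A v) this
    simpa [Function.comp_def] using h2
  rw [← h]
  exact fderiv_eval (p i) x v

@[simp]
lemma normalDeriv_zero {d : ℕ} (n : Space d) (f : Space d → Space d) :
    normalDeriv n 0 f = f := by
  ext1 x; simp [normalDeriv]

lemma normalDeriv_succ {d : ℕ} (n : Space d) (j : ℕ) {f : Space d → Space d}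
    (hf : ContDiff ℝ (⊤ : ℕ∞) f) :
    normalDeriv n (j + 1) f = fun x => fderiv ℝ (normalDeriv n j f) x n := by
  ext1 x
  have hd : DifferentiableAt ℝ (iteratedFDeriv ℝ j f) x :=
    (hf.differentiable_iteratedFDeriv (by exact_mod_cast WithTop.coe_lt_top j)) x
  have : normalDeriv n j f = fun y => iteratedFDeriv ℝ j f y fun _ => n := rfl
  rw [this, fderiv_continuousMultilinear_apply_const_apply hd]
  rfl

/-- Normal derivatives of polynomial fields are polynomial fields of no higher degree. -/
lemma exists_normalDeriv_polyField {d : ℕ} (n : Space d) {k : ℕ}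
    {p : Fin d → MvPolynomial (Fin d) ℝ} (hp : ∀ i, (p i).totalDegree ≤ k) (j : ℕ) :
    ∃ q : Fin d → MvPolynomial (Fin d) ℝ, (∀ i, (q i).totalDegree ≤ k) ∧
      normalDeriv n j (polyField p) = polyField q := by
  induction j with
  | zero => exact ⟨p, hp, normalDeriv_zero _ _⟩
  | succ j ih =>
    obtain ⟨q, hq, h⟩ := ih
    refine ⟨fun i => dirDeriv (fun l => n l) (q i),
      fun i => (totalDegree_dirDeriv_le _ _).trans (hq i), ?_⟩
    rw [normalDeriv_succ n j (contDiff_polyField p), h]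
    ext1 x
    exact fderiv_polyField q x n

lemma normalDeriv_sub {d : ℕ} (n : Space d) (j : ℕ) {f g : Space d → Space d}
    (hf : ContDiff ℝ (⊤ : ℕ∞) f) (hg : ContDiff ℝ (⊤ : ℕ∞) g) (x : Space d) :
    normalDeriv n j (f - g) x = normalDeriv n j f x - normalDeriv n j g x := by
  simp only [normalDeriv]
  rw [iteratedFDeriv_sub_apply (hf.contDiffAt.of_le (by exact_mod_cast le_top))
    (hg.contDiffAt.of_le (by exact_mod_cast le_top))]
  rfl

/-! ### The inverse inequality on the reference simplex -/

/-- On a finite-dimensional space every quadratic form is bounded by any positive definite one. -/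
lemma exists_forall_le_mul_of_pos_def {V : Type*} [AddCommGroup V] [Module ℝ V]
    [FiniteDimensional ℝ V] (A B : V →ₗ[ℝ] V →ₗ[ℝ] ℝ) (hB : ∀ x, x ≠ 0 → 0 < B x x) :
    ∃ C : ℝ, 0 < C ∧ ∀ x, A x x ≤ C * B x x := by
  let e := (Module.finBasis ℝ V).equivFun
  have hcont : ∀ A : V →ₗ[ℝ] V →ₗ[ℝ] ℝ, Continuous fun x => A (e.symm x) (e.symm x) := by
    intro A
    let A' := LinearMap.toContinuousLinearMap.toLinearMap ∘ₗ
      (A.compl₁₂ e.symm.toLinearMap e.symm.toLinearMap)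
    have hA' : Continuous A' := A'.continuous_of_finiteDimensional
    exact hA'.clm_apply continuous_id
  have hK : IsCompact (Metric.sphere (0 : Fin (Module.finrank ℝ V) → ℝ) 1) := isCompact_sphere 0 1
  have hpos : ∀ y ∈ Metric.sphere (0 : Fin (Module.finrank ℝ V) → ℝ) 1,
      0 < B (e.symm y) (e.symm y) := by
    intro y hy
    refine hB _ fun h => ?_
    rw [LinearEquiv.map_eq_zero_iff] at h
    simp [h] at hy
  -- The quotient of the two forms is homogeneous of degree zero and bounded on the unit sphere.
  obtain ⟨C, hC⟩ := hK.bddAbove_image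
    (f := fun y => A (e.symm y) (e.symm y) / B (e.symm y) (e.symm y))
    ((hcont A).continuousOn.div (hcont B).continuousOn fun y hy => (hpos y hy).ne')
  refine ⟨max C 1, by positivity, fun x => ?_⟩
  by_cases hx : x = 0
  · simp [hx]
  have hn : 0 < ‖e x‖ := norm_pos_iff.2 (by simpa using hx)
  have hy : ‖e x‖⁻¹ • e x ∈ Metric.sphere (0 : Fin (Module.finrank ℝ V) → ℝ) 1 := by
    simp [norm_smul, hn.ne']
  have h1 := hC ⟨_, hy, rfl⟩
  have h2 : A x x / B x x ≤ C := by
    refine le_trans (le_of_eq ?_) h1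
    have := (hB x hx).ne'
    simp only [map_smul, LinearEquiv.symm_apply_apply, LinearMap.smul_apply, smul_eq_mul]
    field_simp
  calc A x x ≤ C * B x x := (div_le_iff₀ (hB x hx)).1 h2
    _ ≤ max C 1 * B x x := by
      gcongr
      · exact (hB x hx).le
      · exact le_max_left _ _

/-- The reference simplex in `ℝ^m`. -/
def refSimplex (m : ℕ) : Set (Fin m → ℝ) := {y | (∀ i, 0 ≤ y i) ∧ ∑ i, y i ≤ 1}

lemma isCompact_refSimplex (m : ℕ) : IsCompact (refSimplex m) := by
  refine (isCompact_Icc (a := (0 : Fin m → ℝ)) (b := 1)).of_isClosed_subset ?_ ?_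
  · have h : refSimplex m = (⋂ i, {y | 0 ≤ y i}) ∩ {y | ∑ i, y i ≤ 1} := by
      ext y; simp [refSimplex]
    rw [h]
    exact (isClosed_iInter fun i => isClosed_le continuous_const (continuous_apply i)).inter
      (isClosed_le (by fun_prop) continuous_const)
  · rintro y ⟨h0, h1⟩
    exact ⟨h0, fun i => (Finset.single_le_sum (fun j _ => h0 j) (Finset.mem_univ i)).trans h1⟩

lemma convex_refSimplex (m : ℕ) : Convex ℝ (refSimplex m) := by
  rintro x ⟨hx, hx'⟩ y ⟨hy, hy'⟩ a b ha hb hab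
  refine ⟨fun i => ?_, ?_⟩
  · have := hx i
    have := hy i
    simp only [Pi.add_apply, Pi.smul_apply, smul_eq_mul]
    positivity
  · simp only [Pi.add_apply, Pi.smul_apply, smul_eq_mul, Finset.sum_add_distrib, ← Finset.mul_sum]
    nlinarith

/-- Almost every point of the reference simplex has positive barycentric coordinates. -/
lemma ae_pos_refSimplex (m : ℕ) :
    ∀ᵐ y ∂(volume.restrict (refSimplex m)), (∀ i, 0 < y i) ∧ ∑ i, y i < 1 := by
  have hfr : ∀ᵐ y : Fin m → ℝ, y ∉ frontier (refSimplex m) := by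
    rw [ae_iff]
    simpa using (convex_refSimplex m).addHaar_frontier volume
  rw [ae_restrict_iff' (isCompact_refSimplex m).measurableSet]
  filter_upwards [hfr] with y hy hS
  have hint : y ∈ interior (refSimplex m) := by
    by_contra h
    exact hy ⟨subset_closure hS, h⟩
  -- A small step from an interior point in any direction stays in the simplex.
  have step : ∀ v : Fin m → ℝ, ∃ t : ℝ, 0 < t ∧ y + t • v ∈ refSimplex m := by
    intro v
    have hc : Tendsto (fun t : ℝ => y + t • v) (𝓝[>] 0) (𝓝 y) := by
      have : Continuous fun t : ℝ => y + t • v := by fun_prop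
      simpa using (this.tendsto 0).mono_left nhdsWithin_le_nhds
    obtain ⟨t, h1, h2⟩ :=
      ((hc.eventually (mem_interior_iff_mem_nhds.1 hint)).and self_mem_nhdsWithin).exists
    exact ⟨t, h2, h1⟩
  refine ⟨fun i => ?_, ?_⟩
  · obtain ⟨t, ht, h⟩ := step (-Pi.single i 1)
    have := h.1 i
    simp only [Pi.add_apply, Pi.smul_apply, Pi.neg_apply, Pi.single_eq_same, smul_eq_mul] at this
    linarith
  · rcases Nat.eq_zero_or_pos m with rfl | hm
    · simp
    obtain ⟨t, ht, h⟩ := step 1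
    have := h.2
    simp only [Pi.add_apply, Pi.smul_apply, Pi.one_apply, smul_eq_mul, Finset.sum_add_distrib,
      Finset.sum_const, Finset.card_univ, Fintype.card_fin, nsmul_eq_mul, mul_one] at this
    have : 0 < (m : ℝ) * t := by positivity
    linarith

lemma integrableOn_refSimplex {m : ℕ} {f : (Fin m → ℝ) → ℝ} (hf : Continuous f) :
    IntegrableOn f (refSimplex m) :=
  hf.continuousOn.integrableOn_compact (isCompact_refSimplex m)

/-- The `L²` inner product of polynomials on the reference simplex. -/
def refMass (m : ℕ) : MvPolynomial (Fin m) ℝ →ₗ[ℝ] MvPolynomial (Fin m) ℝ →ₗ[ℝ] ℝ :=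
  LinearMap.mk₂ ℝ
    (fun p q => ∫ y in refSimplex m, MvPolynomial.eval y p * MvPolynomial.eval y q)
    (fun p p' q => by
      simp only [map_add, add_mul]
      exact integral_add
        (integrableOn_refSimplex
          ((MvPolynomial.continuous_eval p).mul (MvPolynomial.continuous_eval q)))
        (integrableOn_refSimplex
          ((MvPolynomial.continuous_eval p').mul (MvPolynomial.continuous_eval q))))
    (fun c p q => by
      simp only [MvPolynomial.smul_eval, mul_assoc, smul_eq_mul]
      exact integral_const_mul _ _)
    (fun p q q' => by
      simp only [map_add, mul_add]
      exact integral_add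
        (integrableOn_refSimplex
          ((MvPolynomial.continuous_eval p).mul (MvPolynomial.continuous_eval q)))
        (integrableOn_refSimplex
          ((MvPolynomial.continuous_eval p).mul (MvPolynomial.continuous_eval q'))))
    (fun c p q => by
      simp only [MvPolynomial.smul_eval, mul_left_comm _ c, smul_eq_mul]
      exact integral_const_mul _ _)

lemma refMass_self (m : ℕ) (p : MvPolynomial (Fin m) ℝ) :
    refMass m p p = ∫ y in refSimplex m, MvPolynomial.eval y p ^ 2 := by
  simp [refMass, sq]

lemma refMass_self_pos (m : ℕ) (p : MvPolynomial (Fin m) ℝ) (hp : p ≠ 0) :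
    0 < refMass m p p := by
  have hcont : Continuous fun y => MvPolynomial.eval y p ^ 2 :=
    (MvPolynomial.continuous_eval p).pow 2
  have hnn : 0 ≤ refMass m p p := by
    rw [refMass_self]
    exact integral_nonneg fun y => sq_nonneg _
  refine lt_of_le_of_ne hnn fun h => hp ?_
  rw [refMass_self, eq_comm, integral_eq_zero_iff_of_nonneg (fun y => sq_nonneg _)
    (integrableOn_refSimplex hcont)] at h
  -- A polynomial that vanishes almost everywhere on a nonempty open box is zero.
  let I : Set ℝ := Set.Ioo 0 (1 / (m + 1))
  have hI : Set.pi Set.univ (fun _ : Fin m => I) ⊆ refSimplex m := by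
    intro y hy
    refine ⟨fun i => (hy i trivial).1.le, ?_⟩
    have : ∑ i, y i ≤ ∑ _i : Fin m, (1 / (m + 1) : ℝ) :=
      Finset.sum_le_sum fun i _ => (hy i trivial).2.le
    refine this.trans ?_
    simp only [Finset.sum_const, Finset.card_univ, Fintype.card_fin, nsmul_eq_mul]
    rw [mul_one_div, div_le_one (by positivity)]
    linarith
  have hopen : IsOpen (Set.pi Set.univ (fun _ : Fin m => I)) :=
    isOpen_set_pi Set.finite_univ fun _ _ => isOpen_Ioo
  have h' := Measure.eqOn_open_of_ae_eq (ae_restrict_of_ae_restrict_of_subset hI h) hopen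
    hcont.continuousOn continuousOn_const
  refine MvPolynomial.funext_set (fun _ => I) (fun _ => Set.Ioo_infinite (by positivity)) ?_
  intro y hy
  have := h' hy
  simpa using this

/-- The inverse inequality on the reference simplex. -/
lemma exists_inverse_refSimplex (m k : ℕ) :
    ∃ C : ℝ, 0 < C ∧ ∀ (i : Fin m) (p : MvPolynomial (Fin m) ℝ), p.totalDegree ≤ k →
      ∫ y in refSimplex m, MvPolynomial.eval y (dirDeriv (Pi.single i 1) p) ^ 2 ≤
        C * ∫ y in refSimplex m, MvPolynomial.eval y p ^ 2 := by
  have key : ∀ i : Fin m, ∃ C : ℝ, 0 < C ∧ ∀ p : MvPolynomial (Fin m) ℝ, p.totalDegree ≤ k →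
      ∫ y in refSimplex m, MvPolynomial.eval y (dirDeriv (Pi.single i 1) p) ^ 2 ≤
        C * ∫ y in refSimplex m, MvPolynomial.eval y p ^ 2 := by
    intro i
    let ι := (MvPolynomial.restrictTotalDegree (Fin m) ℝ k).subtype
    let D := (dirDeriv (Pi.single i 1 : Fin m → ℝ)).toLinearMap ∘ₗ ι
    obtain ⟨C, hC, h⟩ := exists_forall_le_mul_of_pos_def ((refMass m).compl₁₂ D D)
      ((refMass m).compl₁₂ ι ι) fun x hx => refMass_self_pos m _ (by simpa [ι] using hx)
    refine ⟨C, hC, fun p hp => ?_⟩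
    have := h ⟨p, (MvPolynomial.mem_restrictTotalDegree _ _ _).2 hp⟩
    simpa only [LinearMap.compl₁₂_apply, refMass_self, D, ι, LinearMap.comp_apply,
      Submodule.subtype_apply, Derivation.coeFn_coe] using this
  choose C hC h using key
  refine ⟨1 + ∑ i, C i, add_pos_of_pos_of_nonneg one_pos
    (Finset.sum_nonneg fun i _ => (hC i).le), fun i p hp => (h i p hp).trans ?_⟩
  have := Finset.single_le_sum (fun i _ => (hC i).le) (Finset.mem_univ i)
  exact mul_le_mul_of_nonneg_right (by linarith) (integral_nonneg fun y => sq_nonneg _)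

/-! ### Surface measure and inverse inequality on a parametrized simplex -/

/-- The affine parametrization `y ↦ v₀ + ∑ i, y i • a i`. -/
def affineParam {d m : ℕ} (v₀ : Space d) (a : Fin m → Space d) (y : Fin m → ℝ) : Space d :=
  v₀ + ∑ i, y i • a i

lemma affineParam_eq {d m : ℕ} (v₀ : Space d) (a : Fin m → Space d) :
    affineParam v₀ a = (fun x => v₀ + x) ∘
      (Fintype.linearCombination ℝ a).toContinuousLinearMap := by
  ext1 y
  simp [affineParam, Fintype.linearCombination_apply]

lemma continuous_affineParam {d m : ℕ} (v₀ : Space d) (a : Fin m → Space d) :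
    Continuous (affineParam v₀ a) := by
  unfold affineParam; fun_prop

lemma measurableEmbedding_affineParam {d m : ℕ} (v₀ : Space d) {a : Fin m → Space d}
    (ha : LinearIndependent ℝ a) : MeasurableEmbedding (affineParam v₀ a) := by
  refine (continuous_affineParam v₀ a).measurableEmbedding ?_
  rw [affineParam_eq]
  exact (add_right_injective v₀).comp (ha.fintypeLinearCombination_injective)

/-- The `m`-dimensional surface measure on an affine subspace is a multiple of the Lebesgue measure
of an affine parametrization: its pullback is translation invariant and locally finite. -/
lemma exists_restrict_image_affineParam {d m : ℕ} (v₀ : Space d) {a : Fin m → Space d}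
    (ha : LinearIndependent ℝ a) :
    ∃ K : ℝ≥0, ∀ S : Set (Fin m → ℝ),
      (μHE[m] : Measure (Space d)).restrict (affineParam v₀ a '' S) =
        (K • volume.restrict S).map (affineParam v₀ a) := by
  have hemb := measurableEmbedding_affineParam v₀ ha
  let ν : Measure (Fin m → ℝ) := (μHE[m] : Measure (Space d)).comap (affineParam v₀ a)
  have hν : ∀ S, ν S = μHE[m] (affineParam v₀ a '' S) := fun S => hemb.comap_apply _ S
  have hinv : ν.IsAddLeftInvariant := by
    refine ⟨fun y => Measure.ext fun S hS => ?_⟩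
    rw [Measure.map_apply (measurable_const_add y) hS, hν, hν]
    let w : Space d := ∑ i, y i • a i
    have h : affineParam v₀ a '' S =
        (fun x => w + x) '' (affineParam v₀ a '' ((fun x => y + x) ⁻¹' S)) := by
      rw [Set.image_image]
      ext z
      constructor
      · rintro ⟨s, hs, rfl⟩
        refine ⟨s - y, by simpa using hs, ?_⟩
        simp only [affineParam, w, Pi.sub_apply, sub_smul, Finset.sum_sub_distrib]
        abel
      · rintro ⟨s, hs, rfl⟩
        refine ⟨y + s, hs, ?_⟩
        simp only [affineParam, w, Pi.add_apply, add_smul, Finset.sum_add_distrib]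
        abel
    rw [h, (isometry_add_left w).euclideanHausdorffMeasure_image]
  have hfin : IsFiniteMeasureOnCompacts ν := by
    refine ⟨fun S hS => ?_⟩
    obtain ⟨L, hL⟩ : ∃ L, LipschitzWith L (affineParam v₀ a) := by
      rw [affineParam_eq]
      exact ⟨_, (isometry_add_left v₀).lipschitz.comp
        (Fintype.linearCombination ℝ a).toContinuousLinearMap.lipschitz⟩
    have h1 := hL.hausdorffMeasure_image_le (d := (m : ℝ)) (by positivity) S
    have h2 : (μH[(m : ℝ)] : Measure (Fin m → ℝ)) = volume := by
      have := hausdorffMeasure_pi_real (ι := Fin m)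
      simpa using this
    rw [hν, Measure.euclideanHausdorffMeasure_def, Measure.smul_apply]
    rw [h2] at h1
    refine ENNReal.mul_lt_top ENNReal.coe_lt_top (h1.trans_lt ?_)
    refine ENNReal.mul_lt_top ?_ hS.measure_lt_top
    exact ENNReal.rpow_lt_top_of_nonneg (by positivity) ENNReal.coe_ne_top
  refine ⟨ν.addHaarScalarFactor volume, fun S => ?_⟩
  have h := Measure.isAddLeftInvariant_eq_smul ν (volume : Measure (Fin m → ℝ))
  rw [← Measure.restrict_smul, ← h]
  have hpre : S = affineParam v₀ a ⁻¹' (affineParam v₀ a '' S) :=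
    (Set.preimage_image_eq S hemb.injective).symm
  conv_rhs => rw [hpre]
  rw [← hemb.restrict_map, hemb.map_comap,
    Measure.restrict_restrict_of_subset (Set.image_subset_range _ _)]

lemma setIntegral_image_affineParam {d m : ℕ} (v₀ : Space d) {a : Fin m → Space d}
    (ha : LinearIndependent ℝ a) :
    ∃ K : ℝ≥0, ∀ (S : Set (Fin m → ℝ)) (f : Space d → ℝ),
      ∫ x in affineParam v₀ a '' S, f x ∂(μHE[m]) = K * ∫ y in S, f (affineParam v₀ a y) := by
  obtain ⟨K, hK⟩ := exists_restrict_image_affineParam v₀ ha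
  refine ⟨K, fun S f => ?_⟩
  rw [hK S, (measurableEmbedding_affineParam v₀ ha).integral_map, integral_smul_nnreal_measure]
  rfl

/-- The inverse inequality on a parametrized simplex for derivatives along its edges. The constant
does not depend on the simplex, since the edges are the images of the coordinate directions of
the reference simplex. -/
lemma exists_inverse_affineParam (d m k : ℕ) :
    ∃ C : ℝ, 0 < C ∧ ∀ (v₀ : Space d) (a : Fin m → Space d), LinearIndependent ℝ a →
      ∀ p : Fin d → MvPolynomial (Fin d) ℝ, (∀ l, (p l).totalDegree ≤ k) → ∀ i : Fin m,
      ∫ x in affineParam v₀ a '' refSimplex m, ‖fderiv ℝ (polyField p) x (a i)‖ ^ 2 ∂(μHE[m]) ≤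
        C * ∫ x in affineParam v₀ a '' refSimplex m, ‖polyField p x‖ ^ 2 ∂(μHE[m]) := by
  obtain ⟨C, hC, h⟩ := exists_inverse_refSimplex m k
  refine ⟨C, hC, fun v₀ a ha p hp i => ?_⟩
  obtain ⟨K, hK⟩ := setIntegral_image_affineParam v₀ ha
  have hsum : ∀ q : Fin d → MvPolynomial (Fin d) ℝ,
      ∫ y in refSimplex m, ‖polyField q (affineParam v₀ a y)‖ ^ 2 =
        ∑ l, ∫ y in refSimplex m, MvPolynomial.eval y (affineComp v₀ a (q l)) ^ 2 := by
    intro q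
    rw [← integral_finsetSum (f := fun l y => MvPolynomial.eval y (affineComp v₀ a (q l)) ^ 2) _
      fun l _ => integrableOn_refSimplex ((MvPolynomial.continuous_eval _).pow 2)]
    refine integral_congr_ae (.of_forall fun y => ?_)
    simp only [EuclideanSpace.norm_sq_eq, polyField, eval_affineComp, affineParam,
      Real.norm_eq_abs, sq_abs]
  rw [hK, hK, mul_left_comm]
  refine mul_le_mul_of_nonneg_left ?_ K.coe_nonneg
  simp only [fderiv_polyField]
  rw [hsum, hsum, Finset.mul_sum]
  refine Finset.sum_le_sum fun l _ => ?_
  simp only [← dirDeriv_affineComp]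
  exact h i _ ((totalDegree_affineComp_le _ _ _).trans (hp l))

lemma ae_restrict_image_refSimplex {d m : ℕ} (v₀ : Space d) {a : Fin m → Space d}
    (ha : LinearIndependent ℝ a) :
    ∀ᵐ x ∂((μHE[m] : Measure (Space d)).restrict (affineParam v₀ a '' refSimplex m)),
      ∃ y, (∀ i, 0 < y i) ∧ ∑ i, y i < 1 ∧ x = affineParam v₀ a y := by
  obtain ⟨K, hK⟩ := exists_restrict_image_affineParam v₀ ha
  rw [hK, (measurableEmbedding_affineParam v₀ ha).ae_map_iff]
  refine Measure.ae_smul_measure ?_ K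
  filter_upwards [ae_pos_refSimplex m] with y hy
  exact ⟨y, hy.1, hy.2, rfl⟩

lemma integrableOn_image_refSimplex {d m : ℕ} (v₀ : Space d) {a : Fin m → Space d}
    (ha : LinearIndependent ℝ a) {f : Space d → ℝ} (hf : Continuous f) :
    IntegrableOn f (affineParam v₀ a '' refSimplex m) μHE[m] := by
  obtain ⟨K, hK⟩ := exists_restrict_image_affineParam v₀ ha
  rw [IntegrableOn, hK, (measurableEmbedding_affineParam v₀ ha).integrable_map_iff]
  exact (integrableOn_refSimplex (hf.comp (continuous_affineParam v₀ a))).smul_measure_nnreal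

/-! ### Elements adjacent to a facet, and jumps -/

/-- If a simplex contains a ball of radius `r`, every vector is a combination of its vertices with
coefficients of sum zero and of size at most `1 / r` times the length of the vector. -/
lemma exists_coeff_of_closedBall_subset {d : ℕ} {T : Finset (Space d)} {c : Space d} {r : ℝ}
    (hr : 0 < r) (hB : Metric.closedBall c r ⊆ simplex T) (e : Space d) :
    ∃ w : Space d → ℝ, ∑ v ∈ T, w v = 0 ∧ ∑ v ∈ T, w v • v = e ∧ ∀ v ∈ T, |w v| ≤ ‖e‖ / r := by
  by_cases he : e = 0
  · exact ⟨0, by simp, by simp [he], by simp [he]⟩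
  have hne : 0 < ‖e‖ := norm_pos_iff.2 he
  have h1 : c ∈ simplex T := hB (Metric.mem_closedBall_self hr.le)
  have h2 : c + (r / ‖e‖) • e ∈ simplex T := hB (by
    rw [mem_closedBall_iff_norm, add_sub_cancel_left, norm_smul, Real.norm_eq_abs,
      abs_of_pos (by positivity)]
    field_simp; rfl)
  obtain ⟨w₁, hw₁, hs₁, hc₁⟩ := Finset.mem_convexHull'.1 h1
  obtain ⟨w₂, hw₂, hs₂, hc₂⟩ := Finset.mem_convexHull'.1 h2
  -- The barycentric coordinates change by at most one along a radius of the ball.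
  refine ⟨fun v => (‖e‖ / r) * (w₂ v - w₁ v), ?_, ?_, fun v hv => ?_⟩
  · rw [← Finset.mul_sum, Finset.sum_sub_distrib, hs₁, hs₂]; simp
  · simp only [mul_smul, sub_smul]
    rw [← Finset.smul_sum, Finset.sum_sub_distrib, hc₁, hc₂, add_sub_cancel_left, smul_smul]
    have : ‖e‖ / r * (r / ‖e‖) = 1 := by field_simp
    rw [this, one_smul]
  · have hle₁ : w₁ v ≤ 1 := hs₁ ▸ Finset.single_le_sum (fun y hy => hw₁ y hy) hv
    have hle₂ : w₂ v ≤ 1 := hs₂ ▸ Finset.single_le_sum (fun y hy => hw₂ y hy) hv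
    have h0₁ := hw₁ v hv
    have h0₂ := hw₂ v hv
    rw [abs_mul, abs_of_pos (by positivity : 0 < ‖e‖ / r)]
    refine mul_le_of_le_one_right (by positivity) (abs_le.2 ⟨by linarith, by linarith⟩)

/-- The relative interior of the simplex with affinely independent vertices `F`, i.e. its points
with positive barycentric coordinates. -/
def openSimplex {d : ℕ} (F : Finset (Space d)) : Set (Space d) :=
  {x | ∃ w : Space d → ℝ, (∀ v ∈ F, 0 < w v) ∧ ∑ v ∈ F, w v = 1 ∧ ∑ v ∈ F, w v • v = x}

lemma openSimplex_subset {d : ℕ} (F : Finset (Space d)) : openSimplex F ⊆ simplex F := by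
  rintro x ⟨w, hw, hs, hc⟩
  exact Finset.mem_convexHull'.2 ⟨w, fun v hv => (hw v hv).le, hs, hc⟩

lemma simplex_mono {d : ℕ} {F T : Finset (Space d)} (h : F ⊆ T) : simplex F ⊆ simplex T :=
  convexHull_mono (by exact_mod_cast h)

lemma openSimplex_nonempty {d : ℕ} {F : Finset (Space d)} (hF : F.Nonempty) :
    (openSimplex F).Nonempty := by
  have hc : 0 < (F.card : ℝ) := by exact_mod_cast hF.card_pos
  refine ⟨_, fun _ => (F.card : ℝ)⁻¹, fun _ _ => by positivity, ?_, rfl⟩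
  rw [Finset.sum_const, nsmul_eq_mul, mul_inv_cancel₀ hc.ne']

/-- A simplex that contains a ball has its points with positive barycentric coordinates in the
interior. -/
lemma openSimplex_subset_interior {d : ℕ} {T : Finset (Space d)} {c : Space d} {r : ℝ}
    (hr : 0 < r) (hB : Metric.closedBall c r ⊆ simplex T) :
    openSimplex T ⊆ interior (simplex T) := by
  rintro x ⟨w, hw, hs, hc⟩
  have hT : T.Nonempty := by
    rw [Finset.nonempty_iff_ne_empty]
    rintro rfl
    simp at hs
  obtain ⟨v₀, hv₀, hmin⟩ := T.exists_min_image w hT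
  rw [mem_interior_iff_mem_nhds, Metric.mem_nhds_iff]
  refine ⟨r * w v₀, mul_pos hr (hw v₀ hv₀), fun y hy => ?_⟩
  obtain ⟨w', hs', hc', hb'⟩ := exists_coeff_of_closedBall_subset hr hB (y - x)
  refine Finset.mem_convexHull'.2 ⟨fun v => w v + w' v, fun v hv => ?_, ?_, ?_⟩
  · have h1 := (abs_le.1 (hb' v hv)).1
    have h2 : ‖y - x‖ / r ≤ w v₀ := by
      rw [div_le_iff₀ hr, mul_comm]
      exact (mem_ball_iff_norm.1 hy).le
    linarith [hmin v hv]
  · rw [Finset.sum_add_distrib, hs, hs', add_zero]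
  · simp only [add_smul]
    rw [Finset.sum_add_distrib, hc, hc', add_sub_cancel]

/-- The normal component of a combination of vertices with coefficients of sum zero comes from the
vertex opposite to the facet alone. -/
lemma inner_sum_smul_of_isUnitNormal {d : ℕ} {F : Finset (Space d)} {n a v₀ : Space d}
    (hn : IsUnitNormal n F) (ha : a ∉ F) (hv₀ : v₀ ∈ F) {w : Space d → ℝ}
    (hw : ∑ v ∈ insert a F, w v = 0) :
    inner ℝ n (∑ v ∈ insert a F, w v • v) = w a * inner ℝ n (a - v₀) := by
  have h : ∑ v ∈ insert a F, w v • v = ∑ v ∈ insert a F, w v • (v - v₀) := by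
    simp only [smul_sub]
    rw [Finset.sum_sub_distrib, ← Finset.sum_smul, hw, zero_smul, sub_zero]
  rw [h, Finset.sum_insert ha, inner_add_right, inner_smul_right, inner_sum,
    Finset.sum_eq_zero, add_zero]
  intro v hv
  rw [inner_smul_right, hn.2 v hv v₀ hv₀, mul_zero]

lemma inner_sub_ne_zero {d : ℕ} {F : Finset (Space d)} {n a v₀ c : Space d} {r : ℝ}
    (hn : IsUnitNormal n F) (ha : a ∉ F) (hv₀ : v₀ ∈ F) (hr : 0 < r)
    (hB : Metric.closedBall c r ⊆ simplex (insert a F)) : inner ℝ n (a - v₀) ≠ 0 := by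
  obtain ⟨w, hs, hc, -⟩ := exists_coeff_of_closedBall_subset hr hB n
  have h := inner_sum_smul_of_isUnitNormal hn ha hv₀ hs
  rw [hc, real_inner_self_eq_norm_sq, hn.1] at h
  intro h0
  simp [h0] at h

lemma IsUnitNormal.neg {d : ℕ} {F : Finset (Space d)} {n : Space d} (hn : IsUnitNormal n F) :
    IsUnitNormal (-n) F :=
  ⟨by rw [norm_neg, hn.1], fun x hx y hy => by rw [inner_neg_left, hn.2 x hx y hy, neg_zero]⟩

/-- From a relatively interior point of a facet, one enters the element on the side to which the
normal points. -/
lemma eventually_mem_interior {d : ℕ} {F : Finset (Space d)} {n a v₀ c x : Space d} {r : ℝ}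
    (hn : IsUnitNormal n F) (ha : a ∉ F) (hv₀ : v₀ ∈ F) (hr : 0 < r)
    (hB : Metric.closedBall c r ⊆ simplex (insert a F)) (hpos : 0 < inner ℝ n (a - v₀))
    (hx : x ∈ openSimplex F) :
    ∀ᶠ t in 𝓝[>] (0 : ℝ), x + t • n ∈ interior (simplex (insert a F)) := by
  obtain ⟨w, hs, hc, -⟩ := exists_coeff_of_closedBall_subset hr hB n
  have h := inner_sum_smul_of_isUnitNormal hn ha hv₀ hs
  rw [hc, real_inner_self_eq_norm_sq, hn.1, one_pow] at h
  have hwa : 0 < w a := by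
    by_contra h0
    nlinarith
  obtain ⟨l, hl, hls, hlc⟩ := hx
  have hev : ∀ v ∈ F, ∀ᶠ t in 𝓝[>] (0 : ℝ), 0 < l v + t * w v := by
    intro v hv
    have hc : Tendsto (fun t : ℝ => l v + t * w v) (𝓝[>] 0) (𝓝 (l v)) := by
      have : Continuous fun t : ℝ => l v + t * w v := by fun_prop
      simpa using (this.tendsto 0).mono_left nhdsWithin_le_nhds
    exact hc.eventually (lt_mem_nhds (hl v hv))
  filter_upwards [(Finset.eventually_all F).2 hev, self_mem_nhdsWithin] with t ht ht0
  have ht0 : 0 < t := ht0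
  refine openSimplex_subset_interior hr hB
    ⟨fun v => (if v = a then 0 else l v) + t * w v, fun v hv => ?_, ?_, ?_⟩
  · rcases Finset.mem_insert.1 hv with rfl | hv
    · simpa using mul_pos ht0 hwa
    · simpa only [if_neg (ne_of_mem_of_not_mem hv ha)] using ht v hv
  · rw [Finset.sum_add_distrib, ← Finset.mul_sum, hs, Finset.sum_insert ha, if_pos rfl, mul_zero,
      zero_add, add_zero, ← hls]
    exact Finset.sum_congr rfl fun v hv => if_neg (ne_of_mem_of_not_mem hv ha)
  · simp only [add_smul, mul_smul]
    rw [Finset.sum_add_distrib, ← Finset.smul_sum, hc, Finset.sum_insert ha, if_pos rfl, zero_smul,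
      zero_add, ← hlc]
    congr 1
    exact Finset.sum_congr rfl fun v hv => by rw [if_neg (ne_of_mem_of_not_mem hv ha)]

/-- Two different elements of a conforming mesh lie on different sides of a common facet. -/
lemma inner_mul_inner_neg {d : ℕ} (K : Mesh d) {F : Finset (Space d)} {n a b v₀ c c' : Space d}
    {r r' : ℝ} (hn : IsUnitNormal n F) (hv₀ : v₀ ∈ F) (ha : a ∉ F) (hb : b ∉ F) (hab : a ≠ b)
    (hA : insert a F ∈ K.complex.faces) (hA' : insert b F ∈ K.complex.faces)
    (hr : 0 < r) (hB : Metric.closedBall c r ⊆ simplex (insert a F))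
    (hr' : 0 < r') (hB' : Metric.closedBall c' r' ⊆ simplex (insert b F)) :
    inner ℝ n (a - v₀) * inner ℝ n (b - v₀) < 0 := by
  -- Otherwise both elements contain a common point off the hyperplane of the facet.
  have key : ∀ n : Space d, IsUnitNormal n F → 0 < inner ℝ n (a - v₀) →
      ¬ 0 < inner ℝ n (b - v₀) := by
    intro n hn h1 h2
    obtain ⟨x, hx⟩ := openSimplex_nonempty ⟨v₀, hv₀⟩
    obtain ⟨t, ⟨ht1, ht2⟩, ht0⟩ := (((eventually_mem_interior hn ha hv₀ hr hB h1 hx).and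
      (eventually_mem_interior hn hb hv₀ hr' hB' h2 hx)).and self_mem_nhdsWithin).exists
    have hmem : x + t • n ∈ simplex F := by
      have := K.complex.inter_subset_convexHull hA hA' ⟨interior_subset ht1, interior_subset ht2⟩
      refine convexHull_mono ?_ this
      rintro v ⟨hv1, hv2⟩
      simp only [Finset.coe_insert, Set.mem_insert_iff, Finset.mem_coe] at hv1 hv2 ⊢
      rcases hv1 with rfl | hv1
      · exact hv2.resolve_left hab
      · exact hv1
    have hconst : ∀ y ∈ simplex F, inner ℝ n (y - v₀) = 0 := by
      intro y hy
      obtain ⟨w, -, hs, rfl⟩ := Finset.mem_convexHull'.1 hy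
      have : ∑ v ∈ F, w v • v - v₀ = ∑ v ∈ F, w v • (v - v₀) := by
        simp only [smul_sub]
        rw [Finset.sum_sub_distrib, ← Finset.sum_smul, hs, one_smul]
      rw [this, inner_sum, Finset.sum_eq_zero]
      intro v hv
      rw [inner_smul_right, hn.2 v hv v₀ hv₀, mul_zero]
    have h3 := hconst _ hmem
    rw [add_sub_right_comm, inner_add_right, hconst x (openSimplex_subset F hx), inner_smul_right,
      real_inner_self_eq_norm_sq, hn.1] at h3
    have ht0 : 0 < t := ht0
    simp [ht0.ne'] at h3
  have ha0 := inner_sub_ne_zero hn ha hv₀ hr hB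
  have hb0 := inner_sub_ne_zero hn hb hv₀ hr' hB'
  have k1 := key n hn
  have k2 := key (-n) hn.neg
  simp only [inner_neg_left, Left.neg_pos_iff] at k2
  rcases ha0.lt_or_gt with h | h
  · exact mul_neg_of_neg_of_pos h (lt_of_le_of_ne (not_lt.1 (k2 h)) hb0.symm)
  · exact mul_neg_of_pos_of_neg h (lt_of_le_of_ne (not_lt.1 (k1 h)) hb0)

/-- The jump of a function that is given on each side of `x` by a function continuous up to `x`. -/
lemma jump_eq_sub {d : ℕ} {W : Type*} [NormedAddCommGroup W] {n x : Space d}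
    {S₁ S₂ : Set (Space d)} {φ ψ₁ ψ₂ : Space d → W}
    (hx₁ : x ∈ S₁) (hx₂ : x ∈ S₂) (hψ₁ : ContinuousOn ψ₁ S₁) (hψ₂ : ContinuousOn ψ₂ S₂)
    (h₁ : ∀ y ∈ interior S₁, φ y = ψ₁ y) (h₂ : ∀ y ∈ interior S₂, φ y = ψ₂ y)
    (hev₁ : ∀ᶠ t in 𝓝[>] (0 : ℝ), x + t • n ∈ interior S₁)
    (hev₂ : ∀ᶠ t in 𝓝[>] (0 : ℝ), x - t • n ∈ interior S₂) :
    jump n φ x = ψ₁ x - ψ₂ x := by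
  have key : ∀ (e : Space d) (S : Set (Space d)) (ψ : Space d → W), x ∈ S → ContinuousOn ψ S →
      (∀ y ∈ interior S, φ y = ψ y) → (∀ᶠ t in 𝓝[>] (0 : ℝ), x + t • e ∈ interior S) →
      limUnder (𝓝[>] (0 : ℝ)) (fun t => φ (x + t • e)) = ψ x := by
    intro e S ψ hx hψ h hev
    refine Tendsto.limUnder_eq ?_
    have hc : Tendsto (fun t : ℝ => x + t • e) (𝓝[>] 0) (𝓝[S] x) := by
      refine tendsto_nhdsWithin_iff.2 ⟨?_, hev.mono fun t ht => interior_subset ht⟩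
      have : Continuous fun t : ℝ => x + t • e := by fun_prop
      simpa using (this.tendsto 0).mono_left nhdsWithin_le_nhds
    exact ((hψ x hx).tendsto.comp hc).congr' (hev.mono fun t ht => (h _ ht).symm)
  have h2 := key (-n) S₂ ψ₂ hx₂ hψ₂ h₂ (by simpa [sub_eq_add_neg] using hev₂)
  simp only [smul_neg, ← sub_eq_add_neg] at h2
  rw [jump, key n S₁ ψ₁ hx₁ hψ₁ h₁ hev₁, h2]

/-! ### Estimates on a facet -/

/-- The edges that leave the vertex `vv 0` of the simplex with vertices `vv`. -/
def edges {d m : ℕ} (vv : Fin (m + 1) → Space d) : Fin m → Space d :=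
  fun i => vv i.succ - vv 0

lemma affineParam_edges {d m : ℕ} (vv : Fin (m + 1) → Space d) (y : Fin m → ℝ) :
    affineParam (vv 0) (edges vv) y = (1 - ∑ i, y i) • vv 0 + ∑ i, y i • vv i.succ := by
  simp only [affineParam, edges, smul_sub, Finset.sum_sub_distrib, sub_smul, one_smul,
    Finset.sum_smul]
  abel

lemma linearIndependent_edges {d m : ℕ} {vv : Fin (m + 1) → Space d}
    (h : AffineIndependent ℝ vv) : LinearIndependent ℝ (edges vv) := by
  have h1 := (affineIndependent_iff_linearIndependent_vsub ℝ vv 0).1 h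
  exact h1.comp (fun i : Fin m => ⟨i.succ, Fin.succ_ne_zero i⟩)
    fun i j hij => Fin.succ_injective _ (congrArg Subtype.val hij)

lemma affineParam_mem_openSimplex {d m : ℕ} (vv : Fin (m + 1) ↪ Space d) {y : Fin m → ℝ}
    (h0 : ∀ i, 0 < y i) (h1 : ∑ i, y i < 1) :
    affineParam (vv 0) (edges vv) y ∈ openSimplex (Finset.univ.map vv) := by
  let l : Fin (m + 1) → ℝ := Fin.cons (1 - ∑ i, y i) y
  refine ⟨Function.extend vv l 0, fun v hv => ?_, ?_, ?_⟩
  · obtain ⟨j, -, rfl⟩ := Finset.mem_map.1 hv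
    rw [vv.injective.extend_apply]
    refine Fin.cases ?_ (fun i => ?_) j
    · simpa [l] using h1
    · simpa [l] using h0 i
  · simp [Finset.sum_map, vv.injective.extend_apply, Fin.sum_univ_succ, l]
  · rw [affineParam_edges]
    simp [Finset.sum_map, vv.injective.extend_apply, Fin.sum_univ_succ, l]

lemma simplex_eq_image {d m : ℕ} (vv : Fin (m + 1) ↪ Space d) :
    simplex (Finset.univ.map vv) = affineParam (vv 0) (edges vv) '' refSimplex m := by
  ext x
  constructor
  · intro hx
    obtain ⟨w, hw, hs, hc⟩ := Finset.mem_convexHull'.1 hx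
    rw [Finset.sum_map, Fin.sum_univ_succ] at hs hc
    have hw' : ∀ j, 0 ≤ w (vv j) := fun j => hw _ (Finset.mem_map_of_mem _ (Finset.mem_univ j))
    refine ⟨fun i => w (vv i.succ), ⟨fun i => hw' _, ?_⟩, ?_⟩
    · linarith [hw' 0]
    · rw [affineParam_edges, ← hc, ← hs, add_sub_cancel_right]
  · rintro ⟨y, ⟨h0, h1⟩, rfl⟩
    let l : Fin (m + 1) → ℝ := Fin.cons (1 - ∑ i, y i) y
    refine Finset.mem_convexHull'.2 ⟨Function.extend vv l 0, fun v hv => ?_, ?_, ?_⟩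
    · obtain ⟨j, -, rfl⟩ := Finset.mem_map.1 hv
      rw [vv.injective.extend_apply]
      refine Fin.cases ?_ (fun i => ?_) j
      · simpa [l] using h1
      · simpa [l] using h0 i
    · simp [Finset.sum_map, vv.injective.extend_apply, Fin.sum_univ_succ, l]
    · rw [affineParam_edges]
      simp [Finset.sum_map, vv.injective.extend_apply, Fin.sum_univ_succ, l]

/-- A linear map is controlled by its values on the normal and on the edges of a facet of an
element that contains a ball of radius `r`. -/
lemma norm_apply_le_of_closedBall_subset {d m : ℕ} {W : Type*} [NormedAddCommGroup W]
    [NormedSpace ℝ W] (vv : Fin (m + 1) ↪ Space d) {n a c : Space d} {r : ℝ}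
    (hn : IsUnitNormal n (Finset.univ.map vv)) (ha : a ∉ Finset.univ.map vv) (hr : 0 < r)
    (hB : Metric.closedBall c r ⊆ simplex (insert a (Finset.univ.map vv)))
    (A : Space d →L[ℝ] W) (e : Space d) :
    ‖A e‖ ≤ ‖e‖ * (‖A n‖ + 2 / r * ∑ i, ‖A (edges vv i)‖) := by
  have hv₀ : vv 0 ∈ Finset.univ.map vv := Finset.mem_map_of_mem _ (Finset.mem_univ 0)
  let τ : Space d := e - inner ℝ n e • n
  have hin : |inner ℝ n e| ≤ ‖e‖ := by
    simpa [hn.1] using abs_real_inner_le_norm n e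
  have hτ : ‖τ‖ ≤ 2 * ‖e‖ := by
    refine (norm_sub_le _ _).trans ?_
    rw [norm_smul, hn.1, Real.norm_eq_abs]
    linarith
  have hnτ : inner ℝ n τ = 0 := by
    simp only [τ, inner_sub_right, inner_smul_right, real_inner_self_eq_norm_sq, hn.1]
    ring
  obtain ⟨w, hs, hc, hb⟩ := exists_coeff_of_closedBall_subset hr hB τ
  -- The vertex opposite to the facet does not contribute to a tangential vector.
  have hwa : w a = 0 := by
    have h := inner_sum_smul_of_isUnitNormal hn ha hv₀ hs
    rw [hc, hnτ, eq_comm, mul_eq_zero] at h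
    exact h.resolve_right (inner_sub_ne_zero hn ha hv₀ hr hB)
  rw [Finset.sum_insert ha, hwa, zero_add, Finset.sum_map, Fin.sum_univ_succ] at hs
  rw [Finset.sum_insert ha, hwa, zero_smul, zero_add, Finset.sum_map, Fin.sum_univ_succ] at hc
  have hτe : τ = ∑ i, w (vv i.succ) • edges vv i := by
    rw [← hc, eq_neg_of_add_eq_zero_left hs]
    simp only [edges, smul_sub, Finset.sum_sub_distrib, neg_smul, Finset.sum_smul]
    abel
  have hAτ : ‖A τ‖ ≤ ‖e‖ * (2 / r * ∑ i, ‖A (edges vv i)‖) := by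
    rw [hτe, map_sum, ← mul_assoc, Finset.mul_sum]
    refine norm_sum_le_of_le _ fun i _ => ?_
    rw [map_smul, norm_smul, Real.norm_eq_abs]
    refine mul_le_mul_of_nonneg_right ?_ (norm_nonneg _)
    refine (hb _ (Finset.mem_insert_of_mem
      (Finset.mem_map_of_mem _ (Finset.mem_univ _)))).trans ?_
    rw [← mul_div_assoc, mul_comm ‖e‖]
    gcongr
  have he : e = inner ℝ n e • n + τ := by simp [τ]
  calc ‖A e‖ = ‖inner ℝ n e • A n + A τ‖ := by rw [← map_smul, ← map_add, ← he]
    _ ≤ ‖e‖ * ‖A n‖ + ‖e‖ * (2 / r * ∑ i, ‖A (edges vv i)‖) := by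
      refine (norm_add_le _ _).trans (add_le_add ?_ hAτ)
      rw [norm_smul, Real.norm_eq_abs]
      gcongr
    _ = _ := by ring

/-- On a facet, the size of a field controlled by the full derivative of `∂ₙ^j q` is controlled by
the normal derivatives of order `j + 1` and `j` of the polynomial field `q`. -/
lemma exists_integral_normSq_le (d m k : ℕ) :
    ∃ C : ℝ, 0 < C ∧ ∀ (vv : Fin (m + 1) ↪ Space d) (n : Space d) (r b : ℝ) (j : ℕ)
      (p : Fin d → MvPolynomial (Fin d) ℝ), AffineIndependent ℝ vv →
      (∀ l, (p l).totalDegree ≤ k) → ∀ {W : Type} [NormedAddCommGroup W] (f : Space d → W),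
      (∀ x ∈ openSimplex (Finset.univ.map vv), ‖f x‖ ≤
        b * (‖fderiv ℝ (normalDeriv n j (polyField p)) x n‖ +
          2 / r * ∑ i, ‖fderiv ℝ (normalDeriv n j (polyField p)) x (edges vv i)‖)) →
      ∫ x in simplex (Finset.univ.map vv), ‖f x‖ ^ 2 ∂(μHE[m]) ≤
        C * b ^ 2 *
          (∫ x in simplex (Finset.univ.map vv),
              ‖normalDeriv n (j + 1) (polyField p) x‖ ^ 2 ∂(μHE[m]) +
            (r ^ 2)⁻¹ * ∫ x in simplex (Finset.univ.map vv),
              ‖normalDeriv n j (polyField p) x‖ ^ 2 ∂(μHE[m])) := by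
  obtain ⟨C, hC, hinv⟩ := exists_inverse_affineParam d m k
  refine ⟨2 + 8 * m ^ 2 * C, by positivity,
    fun vv n r b j p haff hp W _ f hf => ?_⟩
  have hli := linearIndependent_edges haff
  obtain ⟨q, hq, hqj⟩ := exists_normalDeriv_polyField n hp j
  rw [normalDeriv_succ n j (contDiff_polyField p), hqj, simplex_eq_image]
  rw [hqj] at hf
  have hinv' := hinv (vv 0) (edges vv) hli q hq
  set S := affineParam (vv 0) (edges vv) '' refSimplex m with hS
  have hint : ∀ e : Space d, IntegrableOn (fun x => ‖fderiv ℝ (polyField q) x e‖ ^ 2) S μHE[m] := by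
    intro e
    refine integrableOn_image_refSimplex _ hli ?_
    simp only [fderiv_polyField]
    exact (contDiff_polyField _ (N := 0)).continuous.norm.pow 2
  set J₁ := ∫ x in S, ‖fderiv ℝ (polyField q) x n‖ ^ 2 ∂(μHE[m]) with hJ₁
  set J₀ := ∫ x in S, ‖polyField q x‖ ^ 2 ∂(μHE[m]) with hJ₀
  have hJ₁0 : 0 ≤ J₁ := integral_nonneg fun x => sq_nonneg _
  have hJ₀0 : 0 ≤ J₀ := integral_nonneg fun x => sq_nonneg _
  have hae : ∀ᵐ x ∂((μHE[m] : Measure (Space d)).restrict S), ‖f x‖ ^ 2 ≤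
      b ^ 2 * (2 * ‖fderiv ℝ (polyField q) x n‖ ^ 2 +
        8 * m * (r ^ 2)⁻¹ * ∑ i, ‖fderiv ℝ (polyField q) x (edges vv i)‖ ^ 2) := by
    filter_upwards [ae_restrict_image_refSimplex (vv 0) hli] with x hx
    obtain ⟨y, h0, h1, rfl⟩ := hx
    have h2 := pow_le_pow_left₀ (norm_nonneg _)
      (hf _ (affineParam_mem_openSimplex vv h0 h1)) 2
    refine h2.trans ?_
    rw [mul_pow]
    refine mul_le_mul_of_nonneg_left ?_ (sq_nonneg b)
    refine add_sq_le.trans ?_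
    have h3 := sq_sum_le_card_mul_sum_sq (s := (Finset.univ : Finset (Fin m)))
      (f := fun i => ‖fderiv ℝ (polyField q) (affineParam (vv 0) (edges vv) y) (edges vv i)‖)
    rw [Finset.card_univ, Fintype.card_fin] at h3
    have h4 : (2 / r) ^ 2 = 4 * (r ^ 2)⁻¹ := by rw [div_pow]; ring
    have h5 : 0 ≤ 4 * (r ^ 2)⁻¹ := by positivity
    rw [mul_pow, h4]
    nlinarith [mul_le_mul_of_nonneg_left h3 h5]
  have hint' : IntegrableOn (fun x => b ^ 2 * (2 * ‖fderiv ℝ (polyField q) x n‖ ^ 2 +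
        8 * m * (r ^ 2)⁻¹ * ∑ i, ‖fderiv ℝ (polyField q) x (edges vv i)‖ ^ 2)) S μHE[m] :=
    (((hint n).const_mul 2).add
      ((integrable_finsetSum _ fun i _ => hint (edges vv i)).const_mul _)).const_mul _
  -- No integrability of `f` is needed: without it the integral on the left is zero.
  have hmono := integral_mono_of_nonneg (.of_forall fun x => sq_nonneg _) hint' hae
  refine hmono.trans ?_
  rw [integral_const_mul, integral_add ((hint n).const_mul 2)
      ((integrable_finsetSum _ fun i _ => hint (edges vv i)).const_mul _),
    integral_const_mul, integral_const_mul, integral_finsetSum _ fun i _ => hint (edges vv i)]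
  have hsum : ∑ i, ∫ x in S, ‖fderiv ℝ (polyField q) x (edges vv i)‖ ^ 2 ∂(μHE[m]) ≤
      m * (C * J₀) := by
    refine (Finset.sum_le_sum fun i _ => hinv' i).trans ?_
    simp
  have hr0 : 0 ≤ (r ^ 2)⁻¹ := by positivity
  have hm0 : 0 ≤ 8 * (m : ℝ) * (r ^ 2)⁻¹ := by positivity
  have h6 := mul_le_mul_of_nonneg_left hsum hm0
  have h7 : 0 ≤ (m : ℝ) ^ 2 * C * J₁ := by positivity
  have h8 : 0 ≤ (r ^ 2)⁻¹ * J₀ := by positivity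
  calc b ^ 2 * (2 * J₁ + 8 * m * (r ^ 2)⁻¹ *
        ∑ i, ∫ x in S, ‖fderiv ℝ (polyField q) x (edges vv i)‖ ^ 2 ∂(μHE[m]))
      ≤ b ^ 2 * ((2 + 8 * m ^ 2 * C) * (J₁ + (r ^ 2)⁻¹ * J₀)) := by
        refine mul_le_mul_of_nonneg_left ?_ (sq_nonneg b)
        nlinarith
    _ = _ := by ring

/-! ### Jumps of finite element functions -/

lemma ae_mem_openSimplex {d m : ℕ} (vv : Fin (m + 1) ↪ Space d) (h : AffineIndependent ℝ vv) :
    ∀ᵐ x ∂((μHE[m] : Measure (Space d)).restrict (simplex (Finset.univ.map vv))),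
      x ∈ openSimplex (Finset.univ.map vv) := by
  rw [simplex_eq_image]
  filter_upwards [ae_restrict_image_refSimplex (vv 0) (linearIndependent_edges h)] with x hx
  obtain ⟨y, h0, h1, rfl⟩ := hx
  exact affineParam_mem_openSimplex vv h0 h1

lemma polyField_sub {d : ℕ} (p q : Fin d → MvPolynomial (Fin d) ℝ) :
    polyField (p - q) = polyField p - polyField q := by
  ext x i
  simp [polyField]

lemma facetInner_self {d : ℕ} {W : Type*} [NormedAddCommGroup W] [InnerProductSpace ℝ W]
    (F : Finset (Space d)) (f : Space d → W) :
    facetInner F f f = ∫ x in simplex F, ‖f x‖ ^ 2 ∂(μHE[d - 1]) := by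
  simp only [facetInner, real_inner_self_eq_norm_sq]

lemma normalJump_self_nonneg {d : ℕ} (c : Config d) (j : ℕ) (F : Finset (Space d))
    (u : Space d → Space d) : 0 ≤ c.normalJump j F u u := by
  rw [Config.normalJump, facetInner_self]
  exact integral_nonneg fun x => sq_nonneg _

lemma Config.mem_active_iff {d : ℕ} {c : Config d} {T : Finset (Space d)} :
    T ∈ c.active ↔ (T ∈ c.mesh.complex.faces ∧ T.card = d + 1) ∧
      (simplex T ∩ c.Ω).Nonempty := by
  simp [Config.active, Mesh.elements]

lemma Config.mem_elements_of_mem_active {d : ℕ} {c : Config d} {T : Finset (Space d)}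
    (hT : T ∈ c.active) : T ∈ c.mesh.elements :=
  (Finset.mem_filter.1 hT).1

lemma Config.card_of_mem_interiorFacets {d : ℕ} {c : Config d} {F : Finset (Space d)}
    (hF : F ∈ c.interiorFacets) : F.card = d := by
  obtain ⟨T, -, hT⟩ := Finset.mem_biUnion.1 (Finset.mem_filter.1 hF).1
  exact (Finset.mem_powersetCard.1 hT).2

lemma Config.Admissible.exists_closedBall {d : ℕ} {c : Config d} {ρ κ : ℝ} {L : ℝ≥0}
    (hc : c.Admissible ρ κ L) {T : Finset (Space d)} (hT : T ∈ c.active) :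
    ∃ (z : Space d) (r : ℝ), 0 < r ∧ c.h ≤ κ * ρ * r ∧ Metric.closedBall z r ⊆ simplex T := by
  obtain ⟨-, h2, z, r, hr, h3, hB⟩ := hc.quasiUniform T (Config.mem_elements_of_mem_active hT)
  refine ⟨z, r, hr, ?_, hB⟩
  have hpos : 0 < κ * Metric.diam (simplex T) := hc.h_pos.trans_le h2
  have hκ : 0 ≤ κ := by
    by_contra h
    nlinarith [Metric.diam_nonneg (s := simplex T)]
  calc c.h ≤ κ * Metric.diam (simplex T) := h2
    _ ≤ κ * (ρ * r) := by gcongr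
    _ = κ * ρ * r := by ring

/-- The local geometry at an interior facet: an enumeration of its vertices and the two adjacent
elements, the first of which lies on the side of the normal. -/
lemma Config.Admissible.exists_facet_geometry {d : ℕ} (hd : 0 < d) {c : Config d} {ρ κ : ℝ}
    {L : ℝ≥0} (hc : c.Admissible ρ κ L) {F : Finset (Space d)} (hF : F ∈ c.interiorFacets) :
    ∃ (vv : Fin (d - 1 + 1) ↪ Space d) (a b z : Space d) (r : ℝ),
      F = Finset.univ.map vv ∧ AffineIndependent ℝ vv ∧ a ∉ F ∧
      insert a F ∈ c.active ∧ insert b F ∈ c.active ∧ 0 < r ∧ c.h ≤ κ * ρ * r ∧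
      Metric.closedBall z r ⊆ simplex (insert a F) ∧
      ∀ x ∈ openSimplex F,
        (∀ᶠ t in 𝓝[>] (0 : ℝ), x + t • c.n F ∈ interior (simplex (insert a F))) ∧
        (∀ᶠ t in 𝓝[>] (0 : ℝ), x - t • c.n F ∈ interior (simplex (insert b F))) := by
  have hcard := Config.card_of_mem_interiorFacets hF
  have hn := hc.normal F hF
  obtain ⟨T₁, T₂, hne, hT⟩ := Finset.card_eq_two.1 (Finset.mem_filter.1 hF).2
  have hT₁ : T₁ ∈ c.active ∧ F ⊆ T₁ := Finset.mem_filter.1 (hT ▸ Finset.mem_insert_self _ _ :)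
  have hT₂ : T₂ ∈ c.active ∧ F ⊆ T₂ := Finset.mem_filter.1
    (hT ▸ Finset.mem_insert_of_mem (Finset.mem_singleton_self _) :)
  have hins : ∀ T ∈ c.active, F ⊆ T → ∃ a ∉ F, insert a F = T := fun T hTa hFT =>
    Finset.exists_eq_insert_iff.2 ⟨hFT, by rw [(Config.mem_active_iff.1 hTa).1.2, hcard]⟩
  obtain ⟨a, ha, rfl⟩ := hins T₁ hT₁.1 hT₁.2
  obtain ⟨b, hb, rfl⟩ := hins T₂ hT₂.1 hT₂.2
  have hab : a ≠ b := fun h => hne (by rw [h])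
  obtain ⟨z, r, hr, hhr, hB⟩ := hc.exists_closedBall hT₁.1
  obtain ⟨z', r', hr', hhr', hB'⟩ := hc.exists_closedBall hT₂.1
  let e := Finset.equivFinOfCardEq (hcard.trans (by omega : d = d - 1 + 1))
  let vv : Fin (d - 1 + 1) ↪ Space d := e.symm.toEmbedding.trans (Function.Embedding.subtype _)
  have hvv : F = Finset.univ.map vv := by
    ext x
    simp only [Finset.mem_map, Finset.mem_univ, true_and]
    constructor
    · exact fun hx => ⟨e ⟨x, hx⟩, by simp [vv]⟩
    · rintro ⟨i, rfl⟩
      exact (e.symm i).2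
  have hind : AffineIndependent ℝ vv := by
    have h1 : AffineIndependent ℝ ((↑) : F → Space d) :=
      (c.mesh.complex.indep (Config.mem_active_iff.1 hT₁.1).1.1).mono
        (by exact_mod_cast hT₁.2)
    exact h1.comp_embedding e.symm.toEmbedding
  obtain ⟨v₀, hv₀⟩ : F.Nonempty := Finset.card_pos.1 (by omega)
  have hsign := inner_mul_inner_neg c.mesh hn hv₀ ha hb hab (Config.mem_active_iff.1 hT₁.1).1.1
    (Config.mem_active_iff.1 hT₂.1).1.1 hr hB hr' hB'
  rcases mul_neg_iff.1 hsign with ⟨h1, h2⟩ | ⟨h1, h2⟩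
  · refine ⟨vv, a, b, z, r, hvv, hind, ha, hT₁.1, hT₂.1, hr, hhr, hB, fun x hx =>
      ⟨eventually_mem_interior hn ha hv₀ hr hB h1 hx, ?_⟩⟩
    simpa [sub_eq_add_neg] using eventually_mem_interior hn.neg hb hv₀ hr' hB'
      (by rwa [inner_neg_left, neg_pos]) hx
  · refine ⟨vv, b, a, z', r', hvv, hind, hb, hT₂.1, hT₁.1, hr', hhr', hB', fun x hx =>
      ⟨eventually_mem_interior hn hb hv₀ hr' hB' h2 hx, ?_⟩⟩
    simpa [sub_eq_add_neg] using eventually_mem_interior hn.neg ha hv₀ hr hB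
      (by rwa [inner_neg_left, neg_pos]) hx

lemma Config.exists_polyField {d k : ℕ} {c : Config d} {u : Space d → Space d}
    (hu : u ∈ c.velocitySpace k) {T : Finset (Space d)} (hT : T ∈ c.active) :
    ∃ p : Fin d → MvPolynomial (Fin d) ℝ, (∀ l, (p l).totalDegree ≤ k) ∧
      ∀ x ∈ simplex T, u x = polyField p x := by
  choose p hp h using fun i => (hu i).2 T hT
  exact ⟨p, hp, fun x hx => by ext i; exact h i x hx⟩

lemma isCompact_simplex {d : ℕ} (T : Finset (Space d)) : IsCompact (simplex T) :=
  T.finite_toSet.isCompact_convexHull ℝ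

lemma Config.Admissible.bddAbove_norm {d : ℕ} {c : Config d} {ρ κ : ℝ} {L : ℝ≥0}
    (hc : c.Admissible ρ κ L) {T S : Finset (Space d)} (hT : T ∈ c.active) (hS : S ⊆ T) :
    BddAbove ((fun x => ‖c.β x‖) '' simplex S) :=
  (isCompact_simplex S).bddAbove_image
    (((hc.lipschitz T hT).continuousOn.mono (simplex_mono hS)).norm)

lemma Config.Admissible.norm_le_supNorm {d : ℕ} {c : Config d} {ρ κ : ℝ} {L : ℝ≥0}
    (hc : c.Admissible ρ κ L) {T S : Finset (Space d)} (hT : T ∈ c.active) (hS : S ⊆ T)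
    {x : Space d} (hx : x ∈ simplex S) : ‖c.β x‖ ≤ supNorm c.β (simplex S) :=
  le_csSup (hc.bddAbove_norm hT hS) ⟨x, hx, rfl⟩

lemma supNorm_nonneg {d : ℕ} (β : Space d → Space d) (s : Set (Space d)) : 0 ≤ supNorm β s :=
  Real.sSup_nonneg (by rintro _ ⟨x, -, rfl⟩; exact norm_nonneg _)

lemma normalDeriv_eventuallyEq {d : ℕ} (n : Space d) (j : ℕ) {S : Set (Space d)}
    {u v : Space d → Space d} (h : ∀ x ∈ S, u x = v x) {y : Space d} (hy : y ∈ interior S) :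
    normalDeriv n j u =ᶠ[𝓝 y] normalDeriv n j v := by
  have h1 : u =ᶠ[𝓝 y] v := by
    filter_upwards [mem_interior_iff_mem_nhds.1 hy] with x hx using h x hx
  filter_upwards [h1.iteratedFDeriv ℝ j] with x hx
  simp only [normalDeriv, hx]

/-- The facetwise estimates behind the comparison of the penalties, with constant `C`: the jump of
`u` itself vanishes, and jumps of convective derivatives and of divergences of `∂ₙ^j u` are bounded
by jumps of normal derivatives of orders `j + 1` and `j`. -/
def Config.FacetEstimates {d : ℕ} (c : Config d) (C : ℝ) (u : Space d → Space d) : Prop :=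
  ∀ F ∈ c.interiorFacets,
    c.normalJump 0 F u u = 0 ∧ ∀ j : ℕ,
      facetInner F (jump (c.n F) (convDeriv c.β (normalDeriv (c.n F) j u)))
          (jump (c.n F) (convDeriv c.β (normalDeriv (c.n F) j u))) ≤
        C * supNorm c.β (simplex F) ^ 2 *
          (c.normalJump (j + 1) F u u + (c.h ^ 2)⁻¹ * c.normalJump j F u u) ∧
      facetInner F (jump (c.n F) (divergence (normalDeriv (c.n F) j u)))
          (jump (c.n F) (divergence (normalDeriv (c.n F) j u))) ≤
        C * (c.normalJump (j + 1) F u u + (c.h ^ 2)⁻¹ * c.normalJump j F u u)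

/-- The facetwise estimates hold with a constant that depends only on the dimension, the degree and
the mesh regularity. -/
lemma exists_facetEstimates {d : ℕ} (hd : 0 < d) (k : ℕ) (ρ κ : ℝ) :
    ∃ C : ℝ, 0 < C ∧ ∀ (c : Config d) (L : ℝ≥0), c.Admissible ρ κ L →
      ∀ u ∈ c.velocitySpace k, c.FacetEstimates C u := by
  obtain ⟨C, hC, hest⟩ := exists_integral_normSq_le d (d - 1) k
  refine ⟨C * d ^ 2 * (1 + (κ * ρ) ^ 2), by positivity, fun c L hc u hu F hF => ?_⟩
  have hn := hc.normal F hF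
  obtain ⟨vv, a, b, z, r, hvv, hind, ha, hTa, hTb, hr, hhr, hB, hside⟩ :=
    hc.exists_facet_geometry hd hF
  obtain ⟨pa, hpa, hua⟩ := Config.exists_polyField hu hTa
  obtain ⟨pb, hpb, hub⟩ := Config.exists_polyField hu hTb
  have hFa : F ⊆ insert a F := Finset.subset_insert _ _
  have hFb : F ⊆ insert b F := Finset.subset_insert _ _
  have hp : ∀ l, ((pa - pb) l).totalDegree ≤ k := fun l =>
    (MvPolynomial.totalDegree_sub _ _).trans (max_le (hpa l) (hpb l))
  set n := c.n F with hn_def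
  have hsm : ∀ p : Fin d → MvPolynomial (Fin d) ℝ, ∀ j,
      ContDiff ℝ 1 (normalDeriv n j (polyField p)) := by
    intro p j
    obtain ⟨q, -, hq⟩ := exists_normalDeriv_polyField n
      (fun i => Finset.le_sup (f := fun i => (p i).totalDegree) (Finset.mem_univ i)) j
    rw [hq]
    exact contDiff_polyField q
  have hfd : ∀ p : Fin d → MvPolynomial (Fin d) ℝ, ∀ j,
      Continuous (fderiv ℝ (normalDeriv n j (polyField p))) := fun p j =>
    (hsm p j).continuous_fderiv one_ne_zero
  have hsub : ∀ j, normalDeriv n j (polyField (pa - pb)) =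
      normalDeriv n j (polyField pa) - normalDeriv n j (polyField pb) := by
    intro j
    ext1 x
    rw [polyField_sub]
    exact normalDeriv_sub n j (contDiff_polyField pa) (contDiff_polyField pb) x
  have hfsub : ∀ j x, fderiv ℝ (normalDeriv n j (polyField (pa - pb))) x =
      fderiv ℝ (normalDeriv n j (polyField pa)) x -
        fderiv ℝ (normalDeriv n j (polyField pb)) x := by
    intro j x
    rw [hsub, fderiv_sub ((hsm pa j).differentiable one_ne_zero x)
      ((hsm pb j).differentiable one_ne_zero x)]
  have hloc : ∀ (T : Finset (Space d)) (p : Fin d → MvPolynomial (Fin d) ℝ),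
      (∀ x ∈ simplex T, u x = polyField p x) → ∀ j, ∀ y ∈ interior (simplex T),
        normalDeriv n j u =ᶠ[𝓝 y] normalDeriv n j (polyField p) :=
    fun T p h j y hy => normalDeriv_eventuallyEq n j h hy
  -- The jumps are those of the polynomial field `pa - pb`.
  have hjN : ∀ j, ∀ x ∈ openSimplex F,
      jump n (normalDeriv n j u) x = normalDeriv n j (polyField (pa - pb)) x := by
    intro j x hx
    have hxF := openSimplex_subset F hx
    rw [hsub, Pi.sub_apply]
    exact jump_eq_sub (simplex_mono hFa hxF) (simplex_mono hFb hxF)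
      (hsm pa j).continuous.continuousOn (hsm pb j).continuous.continuousOn
      (fun y hy => (hloc _ pa hua j y hy).eq_of_nhds)
      (fun y hy => (hloc _ pb hub j y hy).eq_of_nhds) (hside x hx).1 (hside x hx).2
  have hjC : ∀ j, ∀ x ∈ openSimplex F,
      jump n (convDeriv c.β (normalDeriv n j u)) x =
        fderiv ℝ (normalDeriv n j (polyField (pa - pb))) x (c.β x) := by
    intro j x hx
    have hxF := openSimplex_subset F hx
    rw [hfsub]
    exact jump_eq_sub (simplex_mono hFa hxF) (simplex_mono hFb hxF)
      ((hfd pa j).continuousOn.clm_apply (hc.lipschitz _ hTa).continuousOn)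
      ((hfd pb j).continuousOn.clm_apply (hc.lipschitz _ hTb).continuousOn)
      (fun y hy => by simp only [convDeriv, (hloc _ pa hua j y hy).fderiv_eq])
      (fun y hy => by simp only [convDeriv, (hloc _ pb hub j y hy).fderiv_eq])
      (hside x hx).1 (hside x hx).2
  have hjD : ∀ j, ∀ x ∈ openSimplex F,
      jump n (divergence (normalDeriv n j u)) x =
        divergence (normalDeriv n j (polyField (pa - pb))) x := by
    intro j x hx
    have hxF := openSimplex_subset F hx
    have hcont : ∀ p, Continuous (divergence (normalDeriv n j (polyField p))) := by
      intro p
      refine continuous_finsetSum _ fun i _ => ?_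
      have := (hfd p j).clm_apply (continuous_const (y := EuclideanSpace.single i (1 : ℝ)))
      fun_prop
    have : divergence (normalDeriv n j (polyField (pa - pb))) x =
        divergence (normalDeriv n j (polyField pa)) x -
          divergence (normalDeriv n j (polyField pb)) x := by
      simp only [divergence, hfsub, ← Finset.sum_sub_distrib]
      rfl
    rw [this]
    exact jump_eq_sub (simplex_mono hFa hxF) (simplex_mono hFb hxF)
      (hcont pa).continuousOn (hcont pb).continuousOn
      (fun y hy => by simp only [divergence, (hloc _ pa hua j y hy).fderiv_eq])
      (fun y hy => by simp only [divergence, (hloc _ pb hub j y hy).fderiv_eq])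
      (hside x hx).1 (hside x hx).2
  have hNJ : ∀ j, c.normalJump j F u u = ∫ x in simplex (Finset.univ.map vv),
      ‖normalDeriv n j (polyField (pa - pb)) x‖ ^ 2 ∂(μHE[d - 1]) := by
    intro j
    rw [Config.normalJump, facetInner_self, hvv]
    refine integral_congr_ae ?_
    filter_upwards [ae_mem_openSimplex vv hind] with x hx
    rw [← hvv, hjN j x (hvv ▸ hx)]
  have hpt : ∀ (A : Space d →L[ℝ] Space d) (e : Space d), ‖A e‖ ≤
      ‖e‖ * (‖A n‖ + 2 / r * ∑ i, ‖A (edges vv i)‖) :=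
    norm_apply_le_of_closedBall_subset vv (hvv ▸ hn) (hvv ▸ ha) hr (hvv ▸ hB)
  -- The radius of the ball is comparable to the mesh size.
  have hrh : (r ^ 2)⁻¹ ≤ (κ * ρ) ^ 2 * (c.h ^ 2)⁻¹ := by
    have hh := hc.h_pos
    have h1 : c.h ^ 2 ≤ (κ * ρ) ^ 2 * r ^ 2 := by
      rw [← mul_pow]
      exact pow_le_pow_left₀ hh.le hhr 2
    rw [← div_eq_mul_inv, le_div_iff₀ (by positivity), inv_mul_le_iff₀ (by positivity)]
    linarith
  have hd1 : (1 : ℝ) ≤ (d : ℝ) ^ 2 := by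
    have : (1 : ℝ) ≤ d := by exact_mod_cast hd
    nlinarith
  have hscale : ∀ j, ∀ B : ℝ, C * B ^ 2 *
      (c.normalJump (j + 1) F u u + (r ^ 2)⁻¹ * c.normalJump j F u u) ≤
        C * (1 + (κ * ρ) ^ 2) * B ^ 2 *
          (c.normalJump (j + 1) F u u + (c.h ^ 2)⁻¹ * c.normalJump j F u u) := by
    intro j B
    have h1 := normalJump_self_nonneg c (j + 1) F u
    have h2 := normalJump_self_nonneg c j F u
    have h3 := mul_le_mul_of_nonneg_right hrh h2
    have h4 : 0 ≤ (κ * ρ) ^ 2 * c.normalJump (j + 1) F u u := by positivity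
    have h5 : 0 ≤ (c.h ^ 2)⁻¹ * c.normalJump j F u u := by positivity
    calc _ ≤ C * B ^ 2 * ((1 + (κ * ρ) ^ 2) *
          (c.normalJump (j + 1) F u u + (c.h ^ 2)⁻¹ * c.normalJump j F u u)) :=
        mul_le_mul_of_nonneg_left (by nlinarith) (by positivity)
      _ = _ := by ring
  have hX : ∀ j, 0 ≤ c.normalJump (j + 1) F u u + (c.h ^ 2)⁻¹ * c.normalJump j F u u := by
    intro j
    have h1 := normalJump_self_nonneg c (j + 1) F u
    have h2 := normalJump_self_nonneg c j F u
    positivity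
  refine ⟨?_, fun j => ⟨?_, ?_⟩⟩
  · rw [hNJ 0, ← hvv]
    refine (setIntegral_congr_fun (isCompact_simplex F).measurableSet fun x hx => ?_).trans
      (integral_zero _ _)
    simp only [normalDeriv_zero, polyField_sub, Pi.sub_apply,
      ← hua x (simplex_mono hFa hx), ← hub x (simplex_mono hFb hx), sub_self, norm_zero]
    norm_num
  · have h := hest vv n r (supNorm c.β (simplex F)) j (pa - pb) hind hp
      (jump n (convDeriv c.β (normalDeriv n j u))) (fun x hx => by
        rw [← hvv] at hx
        rw [hjC j x hx]
        refine (hpt _ _).trans (mul_le_mul_of_nonneg_right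
          (hc.norm_le_supNorm hTa hFa (openSimplex_subset F hx)) ?_)
        positivity)
    rw [← hNJ, ← hNJ, ← hvv] at h
    rw [facetInner_self]
    refine h.trans ((hscale j _).trans ?_)
    refine mul_le_mul_of_nonneg_right ?_ (hX j)
    refine mul_le_mul_of_nonneg_right ?_ (sq_nonneg _)
    have : 0 ≤ C * (1 + (κ * ρ) ^ 2) := by positivity
    nlinarith
  · have h := hest vv n r d j (pa - pb) hind hp
      (jump n (divergence (normalDeriv n j u))) (fun x hx => by
        rw [← hvv] at hx
        rw [hjD j x hx, divergence]
        refine (norm_sum_le_of_le _ fun i _ => (PiLp.norm_apply_le _ i).trans (hpt _ _)).trans ?_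
        simp [mul_add])
    rw [← hNJ, ← hNJ, ← hvv] at h
    rw [facetInner_self]
    refine h.trans ((hscale j _).trans (le_of_eq ?_))
    ring

/-! ### Comparison of the penalties -/

lemma Config.card_neighbours {d : ℕ} {c : Config d} {F : Finset (Space d)}
    (hF : F ∈ c.interiorFacets) : (c.neighbours F).card = 2 :=
  (Finset.mem_filter.1 hF).2

lemma Config.facetMean_le {d : ℕ} {c : Config d} {F : Finset (Space d)}
    (hF : F ∈ c.interiorFacets) {φ : Finset (Space d) → ℝ} {B : ℝ}
    (h : ∀ T ∈ c.neighbours F, φ T ≤ B) : c.facetMean φ F ≤ B := by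
  have := Finset.sum_le_card_nsmul _ _ _ h
  rw [Config.card_neighbours hF, nsmul_eq_mul] at this
  push_cast at this
  rw [Config.facetMean]
  linarith

lemma Config.le_facetMean {d : ℕ} {c : Config d} {F : Finset (Space d)}
    (hF : F ∈ c.interiorFacets) {φ : Finset (Space d) → ℝ} {B : ℝ}
    (h : ∀ T ∈ c.neighbours F, B ≤ φ T) : B ≤ c.facetMean φ F := by
  have := Finset.card_nsmul_le_sum _ _ _ h
  rw [Config.card_neighbours hF, nsmul_eq_mul] at this
  push_cast at this
  rw [Config.facetMean]
  linarith

lemma Config.Admissible.phiU_pos {d : ℕ} {c : Config d} {ρ κ : ℝ} {L : ℝ≥0}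
    (hc : c.Admissible ρ κ L) (T : Finset (Space d)) : 0 < c.phiU T := by
  have := hc.h_pos
  have := hc.μ_pos
  have := hc.σ_pos
  have := supNorm_nonneg c.β (simplex T)
  unfold Config.phiU
  positivity

lemma Config.Admissible.facetMean_phiU_nonneg {d : ℕ} {c : Config d} {ρ κ : ℝ} {L : ℝ≥0}
    (hc : c.Admissible ρ κ L) {F : Finset (Space d)} (hF : F ∈ c.interiorFacets) :
    0 ≤ c.facetMean c.phiU F :=
  Config.le_facetMean hF fun T _ => (hc.phiU_pos T).le

lemma Config.Admissible.facetMean_phiB_nonneg {d : ℕ} {c : Config d} {ρ κ : ℝ} {L : ℝ≥0}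
    (hc : c.Admissible ρ κ L) {F : Finset (Space d)} (hF : F ∈ c.interiorFacets) :
    0 ≤ c.facetMean c.phiB F :=
  Config.le_facetMean hF fun T _ => div_nonneg (sq_nonneg _) (hc.phiU_pos T).le

/-- The Lipschitz bound compares the size of `β` on an element with its size on a facet. -/
lemma Config.Admissible.supNorm_simplex_le {d : ℕ} {c : Config d} {ρ κ : ℝ} {L : ℝ≥0}
    (hc : c.Admissible ρ κ L) {T F : Finset (Space d)} (hT : T ∈ c.active) (hFT : F ⊆ T)
    (hF : F.Nonempty) :
    supNorm c.β (simplex T) ≤ supNorm c.β (simplex F) + L * c.h := by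
  obtain ⟨v, hv⟩ := hF
  have hvF : v ∈ simplex F := subset_convexHull ℝ _ hv
  have hvT : v ∈ simplex T := simplex_mono hFT hvF
  refine csSup_le ⟨_, v, hvT, rfl⟩ ?_
  rintro _ ⟨x, hx, rfl⟩
  have h1 : ‖c.β x‖ ≤ ‖c.β v‖ + ‖c.β x - c.β v‖ := by
    simpa using norm_add_le (c.β v) (c.β x - c.β v)
  have h2 : ‖c.β x - c.β v‖ ≤ L * c.h := by
    rw [← dist_eq_norm]
    refine ((hc.lipschitz T hT).dist_le_mul x hx v hvT).trans ?_
    refine mul_le_mul_of_nonneg_left ?_ L.coe_nonneg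
    exact (Metric.dist_le_diam_of_mem (isCompact_simplex T).isBounded hx hvT).trans
      (hc.quasiUniform T (Config.mem_elements_of_mem_active hT)).1
  linarith [hc.norm_le_supNorm hT hFT hvF]

/-- The weight of the divergence penalty is dominated by the sum of the weights of the simplified,
the reactive and the viscous penalty. -/
lemma Config.Admissible.facetMean_phiU_le {d : ℕ} (hd : 0 < d) {c : Config d} {ρ κ : ℝ} {L : ℝ≥0}
    (hc : c.Admissible ρ κ L) {M : ℝ} (hM : 0 ≤ M)
    (h : (L : ℝ) ≤ M * c.σ ∨ c.FacetResolved M) {F : Finset (Space d)}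
    (hF : F ∈ c.interiorFacets) :
    c.facetMean c.phiU F ≤ 4 * (2 + M) ^ 2 * (c.phiBar F + c.σ * c.h ^ 2 + c.μ) := by
  have hh := hc.h_pos
  have hμ := hc.μ_pos
  have hσ := hc.σ_pos
  set b := supNorm c.β (simplex F) with hb_def
  have hb : 0 ≤ b := supNorm_nonneg _ _
  have hT : ∀ T ∈ c.neighbours F,
      supNorm c.β (simplex T) * c.h ≤ (1 + M) * (b * c.h + c.σ * c.h ^ 2) := by
    intro T hTn
    obtain ⟨hTa, hFT⟩ := Finset.mem_filter.1 hTn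
    have h0 : 0 ≤ M * (b * c.h) := by positivity
    have h0' : 0 ≤ M * (c.σ * c.h ^ 2) := by positivity
    have h0'' : 0 ≤ c.σ * c.h ^ 2 := by positivity
    have h0''' : 0 ≤ b * c.h := by positivity
    rcases h with h | h
    · have hne : F.Nonempty := Finset.card_pos.1 (by
        rw [Config.card_of_mem_interiorFacets hF]; exact hd)
      have h1 := hc.supNorm_simplex_le hTa hFT hne
      have h2 : (L : ℝ) * c.h ≤ M * c.σ * c.h := mul_le_mul_of_nonneg_right h hh.le
      have h3 := mul_le_mul_of_nonneg_right (h1.trans (add_le_add_right h2 b)) hh.le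
      nlinarith
    · have h1 := mul_le_mul_of_nonneg_right (h F hF T hTn) hh.le
      nlinarith
  set A := c.μ + b * c.h + c.σ * c.h ^ 2 with hA_def
  have hA : 0 < A := by positivity
  have hphi : ∀ T ∈ c.neighbours F, c.phiU T ≤ (2 + M) * A := by
    intro T hTn
    have h1 := hT T hTn
    have h2 : 0 ≤ (1 + M) * c.μ := by positivity
    have h3 : 0 ≤ b * c.h := by positivity
    rw [Config.phiU]
    nlinarith
  have hphiB : c.h ^ 2 / ((2 + M) * A) ≤ c.facetMean c.phiB F :=
    Config.le_facetMean hF fun T hTn =>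
      div_le_div_of_nonneg_left (sq_nonneg _) (hc.phiU_pos T) (hphi T hTn)
  have hbar : b ^ 2 * (c.h ^ 2 / ((2 + M) * A)) ≤ c.phiBar F :=
    mul_le_mul_of_nonneg_left hphiB (sq_nonneg _)
  have hbar' : (b * c.h) ^ 2 ≤ c.phiBar F * ((2 + M) * A) := by
    rw [← div_le_iff₀ (by positivity)]
    refine le_trans (le_of_eq ?_) hbar
    ring
  have hbar0 : 0 ≤ c.phiBar F := le_trans (by positivity) hbar
  -- Either viscosity and reaction dominate, or the advective part does and is seen by `phiBar`.
  have hAle : A ≤ 4 * (2 + M) * (c.phiBar F + c.σ * c.h ^ 2 + c.μ) := by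
    have hσh : 0 ≤ c.σ * c.h ^ 2 := by positivity
    rcases le_total (b * c.h) (c.μ + c.σ * c.h ^ 2) with hle | hle
    · have : 0 ≤ M * (c.phiBar F + c.σ * c.h ^ 2 + c.μ) := by positivity
      nlinarith
    · have hA2 : A ≤ 2 * (b * c.h) := by linarith
      have hbh : 0 < b * c.h := by linarith
      have h1 : (b * c.h) ^ 2 ≤ c.phiBar F * ((2 + M) * (2 * (b * c.h))) :=
        hbar'.trans (mul_le_mul_of_nonneg_left
          (mul_le_mul_of_nonneg_left hA2 (by positivity)) hbar0)
      have h2 : b * c.h ≤ 2 * (2 + M) * c.phiBar F := by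
        refine le_of_mul_le_mul_right ?_ hbh
        linarith
      have h3 : 0 ≤ (2 + M) * (c.σ * c.h ^ 2 + c.μ) := by positivity
      nlinarith
  calc c.facetMean c.phiU F ≤ (2 + M) * A := Config.facetMean_le hF hphi
    _ ≤ (2 + M) * (4 * (2 + M) * (c.phiBar F + c.σ * c.h ^ 2 + c.μ)) := by gcongr
    _ = _ := by ring

/-- Summation of the facetwise estimates over the orders of the normal derivatives. -/
lemma sum_range_le_two_mul_sum_Icc (k : ℕ) {h : ℝ} (hh : 0 < h) {J : ℕ → ℝ} (h0 : J 0 = 0)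
    (hJ : ∀ j, 0 ≤ J j) :
    ∑ j ∈ Finset.range k, h ^ (2 * j + 1) * (J (j + 1) + (h ^ 2)⁻¹ * J j) ≤
      2 * ∑ j ∈ Finset.Icc 1 k, h ^ (2 * j - 1) * J j := by
  have hterm : ∀ j, h ^ (2 * j + 1) * (J (j + 1) + (h ^ 2)⁻¹ * J j) =
      h ^ (2 * (j + 1) - 1) * J (j + 1) + h ^ (2 * j - 1) * J j := by
    intro j
    have e1 : 2 * (j + 1) - 1 = 2 * j + 1 := by omega
    rw [mul_add, e1]
    congr 1
    -- For `j = 0` the truncated exponent `2 * j - 1` is harmless, since `J 0 = 0`.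
    rcases Nat.eq_zero_or_pos j with rfl | hj
    · simp [h0]
    · have e2 : 2 * j + 1 = (2 * j - 1) + 2 := by omega
      rw [e2, pow_add]
      field_simp
  have hnn : ∀ j, 0 ≤ h ^ (2 * j - 1) * J j := fun j => mul_nonneg (by positivity) (hJ j)
  have h1 : ∑ j ∈ Finset.range k, h ^ (2 * (j + 1) - 1) * J (j + 1) =
      ∑ j ∈ Finset.Icc 1 k, h ^ (2 * j - 1) * J j := by
    rw [Finset.range_eq_Ico, Finset.sum_Ico_add' (fun j => h ^ (2 * j - 1) * J j) 0 k 1]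
    rfl
  have h2 : ∑ j ∈ Finset.range k, h ^ (2 * j - 1) * J j ≤
      ∑ j ∈ Finset.Icc 1 k, h ^ (2 * j - 1) * J j := by
    rw [← h1]
    refine (Finset.sum_le_sum_of_subset_of_nonneg
      (Finset.range_mono k.le_succ) fun j _ _ => hnn j).trans ?_
    rw [Finset.sum_range_succ']
    simp [h0]
  simp only [hterm, Finset.sum_add_distrib]
  linarith

lemma Config.ghostFacets_subset {d : ℕ} (c : Config d) : c.ghostFacets ⊆ c.interiorFacets :=
  Finset.filter_subset _ _

lemma Config.Admissible.phiBar_nonneg {d : ℕ} {c : Config d} {ρ κ : ℝ} {L : ℝ≥0}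
    (hc : c.Admissible ρ κ L) {F : Finset (Space d)} (hF : F ∈ c.interiorFacets) :
    0 ≤ c.phiBar F :=
  mul_nonneg (sq_nonneg _) (hc.facetMean_phiB_nonneg hF)

lemma Config.Admissible.gBeta_le {d : ℕ} {c : Config d} {ρ κ : ℝ} {L : ℝ≥0}
    (hc : c.Admissible ρ κ L) {C : ℝ} (hC : 0 < C) {u : Space d → Space d}
    (H : c.FacetEstimates C u) (k : ℕ) {γ : ℝ} (hγ : 0 < γ) :
    c.gBeta k γ u u ≤ 2 * C * c.gBar k γ u u := by
  rw [Config.gBeta, Config.gBar, mul_left_comm]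
  refine mul_le_mul_of_nonneg_left ?_ hγ.le
  rw [Finset.mul_sum]
  refine Finset.sum_le_sum fun F hF => ?_
  have hFi := c.ghostFacets_subset hF
  obtain ⟨h0, h⟩ := H F hFi
  have hφ := hc.facetMean_phiB_nonneg hFi
  have hh := hc.h_pos
  have hsum := sum_range_le_two_mul_sum_Icc k hh h0
    fun j => normalJump_self_nonneg c j F u
  calc _ ≤ ∑ j ∈ Finset.range k, C * c.phiBar F * (c.h ^ (2 * j + 1) *
        (c.normalJump (j + 1) F u u + (c.h ^ 2)⁻¹ * c.normalJump j F u u)) := by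
        refine Finset.sum_le_sum fun j _ => ?_
        refine (mul_le_mul_of_nonneg_left (h j).1 (by positivity)).trans (le_of_eq ?_)
        rw [Config.phiBar]
        ring
    _ ≤ C * c.phiBar F * (2 * ∑ j ∈ Finset.Icc 1 k, c.h ^ (2 * j - 1) *
        c.normalJump j F u u) := by
        rw [← Finset.mul_sum]
        refine mul_le_mul_of_nonneg_left hsum ?_
        rw [Config.phiBar]
        positivity
    _ = _ := by
        simp only [Finset.mul_sum]
        exact Finset.sum_congr rfl fun j _ => by ring

lemma Config.Admissible.sBeta_le {d : ℕ} {c : Config d} {ρ κ : ℝ} {L : ℝ≥0}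
    (hc : c.Admissible ρ κ L) {C : ℝ} (hC : 0 < C) {u : Space d → Space d}
    (H : c.FacetEstimates C u) {γ : ℝ} (hγ : 0 < γ) :
    c.sBeta γ u u ≤ 2 * C * c.sBar γ u u := by
  rw [Config.sBeta, Config.sBar, mul_left_comm]
  refine mul_le_mul_of_nonneg_left ?_ hγ.le
  rw [Finset.mul_sum]
  refine Finset.sum_le_sum fun F hF => ?_
  obtain ⟨h0, h⟩ := H F hF
  have hφ := hc.facetMean_phiB_nonneg hF
  have hh := hc.h_pos
  have h1 := (h 0).1
  rw [normalDeriv_zero, h0, mul_zero, add_zero, zero_add] at h1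
  have hJ := normalJump_self_nonneg c 1 F u
  calc _ ≤ c.facetMean c.phiB F * c.h * (C * supNorm c.β (simplex F) ^ 2 *
        c.normalJump 1 F u u) := mul_le_mul_of_nonneg_left h1 (by positivity)
    _ = C * (c.phiBar F * c.h * c.normalJump 1 F u u) := by
        rw [Config.phiBar]
        ring
    _ ≤ 2 * C * (c.phiBar F * c.h * c.normalJump 1 F u u) := by
        have : 0 ≤ c.phiBar F * c.h * c.normalJump 1 F u u := by
          rw [Config.phiBar]
          positivity
        nlinarith

/-- The weight of the divergence penalty, with penalty parameters included. -/
lemma Config.Admissible.mul_facetMean_phiU_le {d : ℕ} (hd0 : 0 < d) {c : Config d} {ρ κ : ℝ}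
    {L : ℝ≥0} (hc : c.Admissible ρ κ L) {M : ℝ} (hM : 0 < M)
    (hLM : (L : ℝ) ≤ M * c.σ ∨ c.FacetResolved M) {γu γσ γμ : ℝ} (hγu : 0 < γu) (hγσ : 0 < γσ)
    (hγμ : 0 < γμ) (hσ : γu ≤ M * γσ) (hμ : γu ≤ M * γμ) {F : Finset (Space d)}
    (hF : F ∈ c.interiorFacets) :
    γu * c.facetMean c.phiU F ≤ 4 * (2 + M) ^ 2 * (1 + M) *
      (γu * c.phiBar F + γσ * (c.σ * c.h ^ 2) + γμ * c.μ) := by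
  have hh := hc.h_pos
  have hσ0 := hc.σ_pos
  have hμ0 := hc.μ_pos
  have hbar := hc.phiBar_nonneg hF
  set D := 4 * (2 + M) ^ 2 with hD_def
  have hD : 0 < D := by positivity
  have h1 := mul_le_mul_of_nonneg_left (hc.facetMean_phiU_le hd0 hM.le hLM hF) hγu.le
  have h2 : γu * (c.phiBar F + c.σ * c.h ^ 2 + c.μ) ≤
      (1 + M) * (γu * c.phiBar F + γσ * (c.σ * c.h ^ 2) + γμ * c.μ) := by
    have h3 : γu * (c.σ * c.h ^ 2) ≤ M * γσ * (c.σ * c.h ^ 2) :=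
      mul_le_mul_of_nonneg_right hσ (by positivity)
    have h4 : γu * c.μ ≤ M * γμ * c.μ := mul_le_mul_of_nonneg_right hμ hμ0.le
    have h5 : 0 ≤ M * (γu * c.phiBar F) :=
      mul_nonneg hM.le (mul_nonneg hγu.le hbar)
    have h6 : 0 ≤ γσ * (c.σ * c.h ^ 2) := by positivity
    have h7 : 0 ≤ γμ * c.μ := by positivity
    nlinarith
  calc _ ≤ γu * (D * (c.phiBar F + c.σ * c.h ^ 2 + c.μ)) := h1
    _ = D * (γu * (c.phiBar F + c.σ * c.h ^ 2 + c.μ)) := by ring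
    _ ≤ D * ((1 + M) * (γu * c.phiBar F + γσ * (c.σ * c.h ^ 2) + γμ * c.μ)) := by gcongr
    _ = _ := by ring

/-- The comparison of the divergence ghost penalties reduces to a bound `E` on the facet weights. -/
lemma Config.Admissible.gU_le {d : ℕ} {c : Config d} {ρ κ : ℝ} {L : ℝ≥0}
    (hc : c.Admissible ρ κ L) {C : ℝ} (hC : 0 < C) {u : Space d → Space d}
    (H : c.FacetEstimates C u) (k : ℕ) {E γu γσ γμ : ℝ} (hγu : 0 < γu)
    (hweight : ∀ F ∈ c.interiorFacets, γu * c.facetMean c.phiU F ≤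
      E * (γu * c.phiBar F + γσ * (c.σ * c.h ^ 2) + γμ * c.μ)) :
    c.gU k γu u u ≤ 2 * C * E * (c.gBar k γu u u + c.gSigma k γσ u u + c.gMu k γμ u u) := by
  have hh := hc.h_pos
  simp only [Config.gU, Config.gBar, Config.gSigma, Config.gMu,
    Finset.mul_sum (s := c.ghostFacets), ← Finset.sum_add_distrib]
  refine Finset.sum_le_sum fun F hF => ?_
  have hFi := c.ghostFacets_subset hF
  obtain ⟨h0, h⟩ := H F hFi
  have hφ := hc.facetMean_phiU_nonneg hFi
  have hsum := sum_range_le_two_mul_sum_Icc k hh h0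
    fun j => normalJump_self_nonneg c j F u
  set S := ∑ j ∈ Finset.Icc 1 k, c.h ^ (2 * j - 1) * c.normalJump j F u u with hS_def
  have hS : 0 ≤ S := Finset.sum_nonneg fun j _ =>
    mul_nonneg (by positivity) (normalJump_self_nonneg c j F u)
  have hS₁ : ∑ j ∈ Finset.Icc 1 k, c.phiBar F * c.h ^ (2 * j - 1) * c.normalJump j F u u =
      c.phiBar F * S := by
    rw [hS_def, Finset.mul_sum]
    exact Finset.sum_congr rfl fun j _ => by ring
  have hS₂ : ∑ j ∈ Finset.Icc 1 k, c.σ * c.h ^ (2 * j + 1) * c.normalJump j F u u =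
      c.σ * c.h ^ 2 * S := by
    rw [hS_def, Finset.mul_sum]
    refine Finset.sum_congr rfl fun j hj => ?_
    have hj1 := (Finset.mem_Icc.1 hj).1
    have e : 2 * j + 1 = 2 + (2 * j - 1) := by omega
    rw [e, pow_add]
    ring
  have hS₃ : ∑ j ∈ Finset.Icc 1 k, c.μ * c.h ^ (2 * j - 1) * c.normalJump j F u u =
      c.μ * S := by
    rw [hS_def, Finset.mul_sum]
    exact Finset.sum_congr rfl fun j _ => by ring
  rw [hS₁, hS₂, hS₃]
  clear_value S
  have hg : ∑ j ∈ Finset.range k, c.facetMean c.phiU F * c.h ^ (2 * j + 1) *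
      facetInner F
        (jump (c.n F) (divergence (normalDeriv (c.n F) j u)))
        (jump (c.n F) (divergence (normalDeriv (c.n F) j u))) ≤
      C * c.facetMean c.phiU F * (2 * S) := by
    refine le_trans (Finset.sum_le_sum fun j _ =>
      mul_le_mul_of_nonneg_left (h j).2 (by positivity)) ?_
    refine le_trans (le_of_eq ?_) (mul_le_mul_of_nonneg_left hsum
      (by positivity : 0 ≤ C * c.facetMean c.phiU F))
    rw [Finset.mul_sum]
    exact Finset.sum_congr rfl fun j _ => by ring
  refine (mul_le_mul_of_nonneg_left hg hγu.le).trans ?_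
  calc γu * (C * c.facetMean c.phiU F * (2 * S))
      = γu * c.facetMean c.phiU F * (2 * C * S) := by ring
    _ ≤ E * (γu * c.phiBar F + γσ * (c.σ * c.h ^ 2) + γμ * c.μ) * (2 * C * S) :=
      mul_le_mul_of_nonneg_right (hweight F hFi) (by positivity)
    _ = _ := by ring

/-- The comparison of the divergence interior penalties reduces to a bound `E` on the facet
weights. -/
lemma Config.Admissible.sU_le {d : ℕ} {c : Config d} {ρ κ : ℝ} {L : ℝ≥0}
    (hc : c.Admissible ρ κ L) {C : ℝ} (hC : 0 < C) {u : Space d → Space d}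
    (H : c.FacetEstimates C u) {E γu γσ γμ : ℝ} (hγu : 0 < γu)
    (hweight : ∀ F ∈ c.interiorFacets, γu * c.facetMean c.phiU F ≤
      E * (γu * c.phiBar F + γσ * (c.σ * c.h ^ 2) + γμ * c.μ)) :
    c.sU γu u u ≤ 2 * C * E * (c.sBar γu u u + c.sSigma γσ u u + c.sMu γμ u u) := by
  have hh := hc.h_pos
  simp only [Config.sU, Config.sBar, Config.sSigma, Config.sMu,
    Finset.mul_sum, ← Finset.sum_add_distrib]
  refine Finset.sum_le_sum fun F hF => ?_
  obtain ⟨h0, h⟩ := H F hF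
  have hφ := hc.facetMean_phiU_nonneg hF
  have h1 := (h 0).2
  rw [normalDeriv_zero, h0, mul_zero, add_zero, zero_add] at h1
  have hJ := normalJump_self_nonneg c 1 F u
  set J := c.normalJump 1 F u u with hJ_def
  have hW : 0 ≤ E * (γu * c.phiBar F + γσ * (c.σ * c.h ^ 2) + γμ * c.μ) :=
    le_trans (by positivity) (hweight F hF)
  calc _ ≤ γu * (c.facetMean c.phiU F * c.h * (C * J)) :=
        mul_le_mul_of_nonneg_left (mul_le_mul_of_nonneg_left h1 (by positivity)) hγu.le
    _ = γu * c.facetMean c.phiU F * (C * (c.h * J)) := by ring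
    _ ≤ E * (γu * c.phiBar F + γσ * (c.σ * c.h ^ 2) + γμ * c.μ) *
        (C * (c.h * J)) :=
      mul_le_mul_of_nonneg_right (hweight F hF) (by positivity)
    _ ≤ E * (γu * c.phiBar F + γσ * (c.σ * c.h ^ 2) + γμ * c.μ) *
        (2 * (C * (c.h * J))) := by
      refine mul_le_mul_of_nonneg_left ?_ hW
      have : 0 ≤ C * (c.h * J) := by positivity
      linarith
    _ = _ := by ring

end CutFEM

end

theorem mainTheorem3 (d k : ℕ) (hd : d = 2 ∨ d = 3) (hk : 1 ≤ k) (ρ κ : ℝ) :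
    (∃ C : ℝ, 0 < C ∧
      ∀ (c : CutFEM.Config d) (L : NNReal), c.Admissible ρ κ L →
      ∀ γβ : ℝ, 0 < γβ →
      ∀ u ∈ c.velocitySpace k,
        c.gBeta k γβ u u ≤ C * c.gBar k γβ u u ∧
        c.sBeta γβ u u ≤ C * c.sBar γβ u u) ∧
    (∀ M : ℝ, ∃ C : ℝ, 0 < C ∧
      ∀ (c : CutFEM.Config d) (L : NNReal), c.Admissible ρ κ L →
      ((L : ℝ) ≤ M * c.σ ∨ c.FacetResolved M) →
      ∀ γu γσ γμ : ℝ, 0 < γu → 0 < γσ → 0 < γμ → γu ≤ M * γσ → γu ≤ M * γμ →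
      ∀ u ∈ c.velocitySpace k,
        c.gU k γu u u ≤ C * (c.gBar k γu u u + c.gSigma k γσ u u + c.gMu k γμ u u) ∧
        c.sU γu u u ≤ C * (c.sBar γu u u + c.sSigma γσ u u + c.sMu γμ u u)) := by
  have hd0 : 0 < d := by omega
  obtain ⟨C, hC, hest⟩ := CutFEM.exists_facetEstimates hd0 k ρ κ
  refine ⟨⟨2 * C, by positivity, fun c L hc γ hγ u hu =>
    ⟨hc.gBeta_le hC (hest c L hc u hu) k hγ, hc.sBeta_le hC (hest c L hc u hu) hγ⟩⟩, fun M => ?_⟩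
  refine ⟨2 * C * (4 * (2 + |M|) ^ 2 * (1 + |M|)), by positivity,
    fun c L hc hLM γu γσ γμ hγu hγσ hγμ hσ hμ u hu => ?_⟩
  -- The hypotheses on the penalty parameters force `M` to be positive.
  have hM : 0 < M := by
    by_contra hM
    nlinarith
  rw [abs_of_pos hM]
  have hweight := fun F (hF : F ∈ c.interiorFacets) =>
    hc.mul_facetMean_phiU_le hd0 hM hLM hγu hγσ hγμ hσ hμ hF
  exact ⟨hc.gU_le hC (hest c L hc u hu) k hγu hweight, hc.sU_le hC (hest c L hc u hu) hγu hweight⟩
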